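/- Let $d\ge 1$, let $\Omega\subset\mathbb{R}^d$ be a bounded Lipschitz domain, let $s\in(0,1)$ with $s\neq\frac12$, and let $\alpha,\beta>0$. Put $c_{d,s}=\frac{s2^{2s}\Gamma(s+\frac d2)}{\pi^{d/2}\Gamma(1-s)}$ and, for $D=\Omega$ or $D=\mathbb{R}^d$, let $$H^s(D)=\Big\{w\in L^2(D):\ \frac{|w(x)-w(y)|}{|x-y|^{\frac d2+s}}\in L^2(D\times D)\Big\},\qquad (u,w)_{H^s(D)}=\int_D uw\,dx+\frac{c_{d,s}}2\int_D\int_D\frac{(u(x)-u(y))(w(x)-w(y))}{|x-y|^{d+2s}}\,dy\,dx .$$ Let $W$ be any one of the following three Hilbert spaces: 1. $H^s_0(\Omega)$, the closure of $C_c^\infty(\Omega)$ in $H^s(\Omega)$, with the inner product of $H^s(\Omega)$; 2. $\tilde H^s(\Omega)=\{w\in H^s(\mathbb{R}^d): w=0 \text{ a.e. on } \mathbb{R}^d\setminus\Omega\}$, with the inner product of $H^s(\mathbb{R}^d)$; 3. the spectral space $\mathbb{H}^s(\Omega)=\{w=\sum_n w_n\phi_n\in L^2(\Omega):\ \|w\|^2_{\mathbb{H}^s(\Omega)}=\sum_n\lambda_n^s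 w_n^2<\infty\}$, where $w_n=\int_\Omega w\phi_n\,dx$ and $(\phi_n)$ is an $L^2(\Omega)$-orthonormal system of all eigenfunctions (counted with multiplicity) of $-\Delta$ on $\Omega$ with zero Dirichlet boundary conditions, to the eigenvalues $\lambda_n$, with the inner product $(u,w)=\sum_n\lambda_n^su_nw_n$. Let $F:W\to\mathbb{R}$ be weakly (sequentially) lower semicontinuous, bounded from below by an affine function (there are $g\in W^*$ and $c\in\mathbb{R}$ with $F(w)\ge g(w)+c$ for all $w\in W$) and continuously Fréchet differentiable. Then the problem $$\min_{w\in W}\ F(w)+\frac\alpha2\|w\|_W^2+\beta\int_\Omega|w|^0\,dx ,\qquad 0^0:=0,$$ has a (global) solution, i.e. its infimum over $W$ is attained. -/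

import Mathlib

open MeasureTheory Filter Topology
open scoped ContDiff ENNReal

noncomputable section

namespace FracSob

/-- The Euclidean space `ℝ^d`. -/
abbrev Eucl (d : ℕ) : Type := EuclideanSpace ℝ (Fin d)

/-! ### Domains and test functions -/

/-- A bounded Lipschitz domain: a nonempty, connected, bounded open set which near each of its
boundary points is, in suitable orthonormal coordinates, the set of points lying strictly below the
graph of a Lipschitz function. Here `e` is the unit vector of the vertical direction, `⟪e, y⟫` is
the vertical coordinate of `y` and `y - ⟪e, y⟫ e` its horizontal part. -/
structure IsBoundedLipschitzDomain {d : ℕ} (Ω : Set (Eucl d)) : Prop where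
  isOpen : IsOpen Ω
  isConnected : IsConnected Ω
  isBounded : Bornology.IsBounded Ω
  lipschitz_boundary : ∀ x ∈ frontier Ω, ∃ e : Eucl d, ‖e‖ = 1 ∧
    ∃ (K : NNReal) (γ : Eucl d → ℝ), LipschitzWith K γ ∧
      ∃ U : Set (Eucl d), IsOpen U ∧ x ∈ U ∧
        ∀ y ∈ U, (y ∈ Ω ↔ inner ℝ e y < γ (y - (inner ℝ e y : ℝ) • e))

/-- `φ ∈ C_c^∞(Ω)`. -/
structure IsTestFunction {d : ℕ} (Ω : Set (Eucl d)) (φ : Eucl d → ℝ) : Prop where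
  contDiff : ContDiff ℝ ∞ φ
  hasCompactSupport : HasCompactSupport φ
  tsupport_subset : tsupport φ ⊆ Ω

/-- The Hilbert space `L²(Ω)`. -/
abbrev L2 {d : ℕ} (Ω : Set (Eucl d)) : Type := Lp ℝ 2 (volume.restrict Ω)

/-! ### The integral fractional Sobolev space `H^s(Ω)` -/

/-- Lebesgue measure on `Ω × Ω`. -/
abbrev prodVolume {d : ℕ} (Ω : Set (Eucl d)) : Measure (Eucl d × Eucl d) :=
  (volume.restrict Ω).prod (volume.restrict Ω)

/-- The function `(x, y) ↦ (w(x) - w(y)) / |x - y|^{d/2 + s}`. -/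
def diffQuotient {d : ℕ} (s : ℝ) (w : Eucl d → ℝ) (z : Eucl d × Eucl d) : ℝ :=
  (w z.1 - w z.2) / ‖z.1 - z.2‖ ^ ((d : ℝ) / 2 + s)

/-- The constant `c_{d,s} = s 2^{2s} Γ(s + d/2) / (π^{d/2} Γ(1-s))`. -/
def fracConst (d : ℕ) (s : ℝ) : ℝ :=
  s * (2 : ℝ) ^ (2 * s) * Real.Gamma (s + (d : ℝ) / 2) /
    (Real.pi ^ ((d : ℝ) / 2) * Real.Gamma (1 - s))

theorem fracConst_nonneg (d : ℕ) (s : Set.Ioo (0 : ℝ) 1) : 0 ≤ fracConst d s := by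
  have h0 := s.2.1
  have h1 := s.2.2
  have hg : 0 < Real.Gamma (1 - (s : ℝ)) := Real.Gamma_pos_of_pos (by linarith)
  have hg' : 0 < Real.Gamma ((s : ℝ) + (d : ℝ) / 2) := Real.Gamma_pos_of_pos (by positivity)
  unfold fracConst
  positivity

theorem diffQuotient_ae_congr {d : ℕ} {Ω : Set (Eucl d)} (s : ℝ) {u w : Eucl d → ℝ}
    (h : u =ᵐ[volume.restrict Ω] w) :
    diffQuotient s u =ᵐ[prodVolume Ω] diffQuotient s w := by
  have h1 : ∀ᵐ z ∂(prodVolume Ω), u z.1 = w z.1 :=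
    Measure.quasiMeasurePreserving_fst.ae h
  have h2 : ∀ᵐ z ∂(prodVolume Ω), u z.2 = w z.2 :=
    Measure.quasiMeasurePreserving_snd.ae h
  filter_upwards [h1, h2] with z hz1 hz2
  simp only [diffQuotient, hz1, hz2]

theorem diffQuotient_add {d : ℕ} {Ω : Set (Eucl d)} (s : ℝ) (u w : L2 Ω) :
    diffQuotient s (u + w : L2 Ω) =ᵐ[prodVolume Ω]
      fun z => diffQuotient s u z + diffQuotient s w z := by
  refine (diffQuotient_ae_congr s (Lp.coeFn_add u w)).trans (Eventually.of_forall fun z => ?_)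
  simp only [diffQuotient, Pi.add_apply]
  ring

theorem diffQuotient_smul {d : ℕ} {Ω : Set (Eucl d)} (s : ℝ) (a : ℝ) (w : L2 Ω) :
    diffQuotient s (a • w : L2 Ω) =ᵐ[prodVolume Ω] fun z => a * diffQuotient s w z := by
  refine (diffQuotient_ae_congr s (Lp.coeFn_smul a w)).trans (Eventually.of_forall fun z => ?_)
  simp only [diffQuotient, Pi.smul_apply, smul_eq_mul]
  ring

/-- `H^s(Ω)` as a linear subspace of `L²(Ω)`: those `w` for which
`(w(x) - w(y)) / |x - y|^{d/2+s}` belongs to `L²(Ω × Ω)`. -/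
def hsSubmodule {d : ℕ} (Ω : Set (Eucl d)) (s : Set.Ioo (0 : ℝ) 1) : Submodule ℝ (L2 Ω) where
  carrier := {w | MemLp (diffQuotient s w) 2 (prodVolume Ω)}
  zero_mem' := by
    have h : diffQuotient s ((0 : L2 Ω) : Eucl d → ℝ) =ᵐ[prodVolume Ω] fun _ => 0 :=
      (diffQuotient_ae_congr s (Lp.coeFn_zero ℝ 2 _)).trans
        (Eventually.of_forall fun z => by simp [diffQuotient])
    exact (memLp_congr_ae h).2 MemLp.zero
  add_mem' := fun {u w} hu hw => (memLp_congr_ae (diffQuotient_add s u w)).2 (MemLp.add hu hw)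
  smul_mem' := fun a w hw =>
    (memLp_congr_ae (diffQuotient_smul s a w)).2 (MemLp.const_mul hw a)

/-- The fractional Sobolev space `H^s(Ω)`. It is a type of its own, since it does not carry the
norm of `L²(Ω)`; its norm is the one induced by the inner product `Hs.innerHs` below. -/
def Hs {d : ℕ} (Ω : Set (Eucl d)) (s : Set.Ioo (0 : ℝ) 1) : Type := hsSubmodule Ω s

namespace Hs

variable {d : ℕ} {Ω : Set (Eucl d)} {s : Set.Ioo (0 : ℝ) 1}

instance : AddCommGroup (Hs Ω s) := inferInstanceAs (AddCommGroup (hsSubmodule Ω s))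

instance : Module ℝ (Hs Ω s) := inferInstanceAs (Module ℝ (hsSubmodule Ω s))

/-- The inclusion `H^s(Ω) ⊆ L²(Ω)`. -/
def toL2 : Hs Ω s →ₗ[ℝ] L2 Ω := (hsSubmodule Ω s).subtype

/-- The inner product
`(u, w) = ∫_Ω u w dx + (c_{d,s} / 2) ∫_Ω ∫_Ω (u(x)-u(y)) (w(x)-w(y)) / |x-y|^{d+2s} dy dx`. -/
def innerHs (u w : Hs Ω s) : ℝ :=
  (∫ x in Ω, toL2 u x * toL2 w x) +
    fracConst d s / 2 * ∫ z, (toL2 u z.1 - toL2 u z.2) * (toL2 w z.1 - toL2 w z.2) /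
      ‖z.1 - z.2‖ ^ ((d : ℝ) + 2 * (s : ℝ)) ∂(prodVolume Ω)

theorem innerHs_eq (u w : Hs Ω s) : innerHs u w = inner ℝ (toL2 u) (toL2 w) +
    fracConst d s / 2 *
      ∫ z, diffQuotient s (toL2 u) z * diffQuotient s (toL2 w) z ∂(prodVolume Ω) := by
  unfold innerHs
  congr 1
  · rw [L2.inner_def]
    refine integral_congr_ae (Eventually.of_forall fun x => ?_)
    simp [mul_comm]
  · congr 1
    refine integral_congr_ae (Eventually.of_forall fun z => ?_)
    have h : ‖z.1 - z.2‖ ^ ((d : ℝ) + 2 * (s : ℝ)) =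
        ‖z.1 - z.2‖ ^ ((d : ℝ) / 2 + s) * ‖z.1 - z.2‖ ^ ((d : ℝ) / 2 + s) := by
      rw [← pow_two, ← Real.rpow_mul_natCast (norm_nonneg _)]
      congr 1
      push_cast
      ring
    simp only [diffQuotient, h]
    rw [div_mul_div_comm]

theorem integrable_mul (u w : Hs Ω s) :
    Integrable (fun z => diffQuotient s (toL2 u) z * diffQuotient s (toL2 w) z)
      (prodVolume Ω) :=
  MemLp.integrable_mul (p := 2) (q := 2) u.2 w.2

/-- The inner product space structure of `H^s(Ω)`. -/
@[reducible] def core : InnerProductSpace.Core ℝ (Hs Ω s) where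
  inner := innerHs
  conj_inner_symm u w := by
    simp only [conj_trivial, innerHs_eq, real_inner_comm, mul_comm]
  re_inner_nonneg u := by
    simp only [innerHs_eq, RCLike.re_to_real]
    have h1 : 0 ≤ inner ℝ (toL2 u) (toL2 u) := real_inner_self_nonneg
    have h2 := fracConst_nonneg d s
    have h3 : 0 ≤ ∫ z, diffQuotient s (toL2 u) z * diffQuotient s (toL2 u) z ∂(prodVolume Ω) :=
      integral_nonneg fun z => mul_self_nonneg _
    positivity
  add_left u v w := by
    simp only [innerHs_eq, map_add, inner_add_left]
    have h : ∫ z, diffQuotient s (toL2 u + toL2 v : L2 Ω) z * diffQuotient s (toL2 w) z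
          ∂(prodVolume Ω) =
        (∫ z, diffQuotient s (toL2 u) z * diffQuotient s (toL2 w) z ∂(prodVolume Ω)) +
          ∫ z, diffQuotient s (toL2 v) z * diffQuotient s (toL2 w) z ∂(prodVolume Ω) := by
      rw [← integral_add (integrable_mul u w) (integrable_mul v w)]
      refine integral_congr_ae ?_
      filter_upwards [diffQuotient_add (s : ℝ) (toL2 u) (toL2 v)] with z hz
      rw [hz]
      ring
    rw [h]
    ring
  smul_left u w a := by
    simp only [innerHs_eq, map_smul, real_inner_smul_left, conj_trivial]
    have h : ∫ z, diffQuotient s (a • toL2 u : L2 Ω) z * diffQuotient s (toL2 w) z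
          ∂(prodVolume Ω) =
        a * ∫ z, diffQuotient s (toL2 u) z * diffQuotient s (toL2 w) z ∂(prodVolume Ω) := by
      rw [← integral_const_mul]
      refine integral_congr_ae ?_
      filter_upwards [diffQuotient_smul (s : ℝ) a (toL2 u)] with z hz
      rw [hz]
      ring
    rw [h]
    ring
  definite u hu := by
    rw [innerHs_eq] at hu
    have h1 : 0 ≤ inner ℝ (toL2 u) (toL2 u) := real_inner_self_nonneg
    have h2 := fracConst_nonneg d s
    have h3 : 0 ≤ ∫ z, diffQuotient s (toL2 u) z * diffQuotient s (toL2 u) z ∂(prodVolume Ω) :=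
      integral_nonneg fun z => mul_self_nonneg _
    have h4 : 0 ≤ fracConst d s / 2 *
      ∫ z, diffQuotient s (toL2 u) z * diffQuotient s (toL2 u) z ∂(prodVolume Ω) := by positivity
    have h5 : inner ℝ (toL2 u) (toL2 u) = 0 := by linarith
    exact Subtype.ext (inner_self_eq_zero.1 h5)

instance : NormedAddCommGroup (Hs Ω s) := core.toNormedAddCommGroup

instance : InnerProductSpace ℝ (Hs Ω s) := InnerProductSpace.ofCore core.toCore

end Hs

/-! ### The spaces `H_0^s(Ω)` and `H̃^s(Ω)` -/

/-- The elements of `H^s(Ω)` that have a representative in `C_c^∞(Ω)`. -/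
def testHs {d : ℕ} (Ω : Set (Eucl d)) (s : Set.Ioo (0 : ℝ) 1) : Set (Hs Ω s) :=
  {w | ∃ φ : Eucl d → ℝ, IsTestFunction Ω φ ∧ Hs.toL2 w =ᵐ[volume.restrict Ω] φ}

/-- `H_0^s(Ω)`: the closure of (the linear subspace) `C_c^∞(Ω)` in `H^s(Ω)`, with the inner
product of `H^s(Ω)`. -/
def H0s {d : ℕ} (Ω : Set (Eucl d)) (s : Set.Ioo (0 : ℝ) 1) : Submodule ℝ (Hs Ω s) :=
  (Submodule.span ℝ (testHs Ω s)).topologicalClosure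

/-- `H̃^s(Ω)`: the elements of `H^s(ℝ^d)` that vanish almost everywhere on `ℝ^d \ Ω`, with the
inner product of `H^s(ℝ^d)`. -/
def HTilde {d : ℕ} (Ω : Set (Eucl d)) (s : Set.Ioo (0 : ℝ) 1) :
    Submodule ℝ (Hs (Set.univ : Set (Eucl d)) s) where
  carrier := {w | ∀ᵐ x ∂(volume : Measure (Eucl d)), x ∉ Ω → Hs.toL2 w x = 0}
  zero_mem' := by
    simp
  add_mem' := fun {u w} hu hw => by
    have h := Lp.coeFn_add (Hs.toL2 u) (Hs.toL2 w)
    replace h := ae_mono (Measure.restrict_univ (μ := (volume : Measure (Eucl d)))).ge h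
    simp only [Set.mem_ofPred_eq, map_add]
    filter_upwards [h, hu, hw] with x hx hux hwx hxΩ
    rw [hx, Pi.add_apply, hux hxΩ, hwx hxΩ, add_zero]
  smul_mem' := fun a w hw => by
    have h := Lp.coeFn_smul a (Hs.toL2 w)
    replace h := ae_mono (Measure.restrict_univ (μ := (volume : Measure (Eucl d)))).ge h
    simp only [Set.mem_ofPred_eq, map_smul]
    filter_upwards [h, hw] with x hx hwx hxΩ
    rw [hx, Pi.smul_apply, hwx hxΩ, smul_zero]

/-! ### The spectral fractional Sobolev space -/

/-- `w ∈ H_0^1(Ω)` with weak gradient `G`: there are `φ_n ∈ C_c^∞(Ω)` with `φ_n → w` in `L²(Ω)`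
and `∇φ_n → G` in `L²(Ω; ℝ^d)`. -/
structure HasH01Gradient {d : ℕ} (Ω : Set (Eucl d)) (w : Eucl d → ℝ) (G : Eucl d → Eucl d) :
    Prop where
  memLp : MemLp w 2 (volume.restrict Ω)
  memLp_grad : MemLp G 2 (volume.restrict Ω)
  approx : ∃ φ : ℕ → Eucl d → ℝ, (∀ n, IsTestFunction Ω (φ n)) ∧
    Tendsto (fun n => eLpNorm (φ n - w) 2 (volume.restrict Ω)) atTop (𝓝 0) ∧
    Tendsto (fun n => eLpNorm (gradient (φ n) - G) 2 (volume.restrict Ω)) atTop (𝓝 0)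

/-- `w` is a weak solution of `-Δ w = lam w` in `Ω`, `w = 0` on `∂Ω`, that is: `w ∈ H_0^1(Ω)` and
`∫_Ω ∇w · ∇v dx = lam ∫_Ω w v dx` for all `v ∈ C_c^∞(Ω)`. -/
def IsDirichletSolution {d : ℕ} (Ω : Set (Eucl d)) (lam : ℝ) (w : Eucl d → ℝ) : Prop :=
  ∃ G : Eucl d → Eucl d, HasH01Gradient Ω w G ∧
    ∀ v : Eucl d → ℝ, IsTestFunction Ω v →
      ∫ x in Ω, inner ℝ (G x) (gradient v x) = lam * ∫ x in Ω, w x * v x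

/-- The eigenspace of the Dirichlet Laplacian on `Ω` for the eigenvalue `lam`, as a closed subspace
of `L²(Ω)`; it is `{0}` if `lam` is not an eigenvalue. (The solutions already form a closed linear
subspace, so that passing to the closed linear span adds nothing.) -/
def dirichletEigenspace {d : ℕ} (Ω : Set (Eucl d)) (lam : ℝ) : Submodule ℝ (L2 Ω) :=
  (Submodule.span ℝ {w : L2 Ω | IsDirichletSolution Ω lam w}).topologicalClosure

instance {d : ℕ} (Ω : Set (Eucl d)) (lam : ℝ) : CompleteSpace (dirichletEigenspace Ω lam) :=
  (Submodule.isClosed_topologicalClosure _).completeSpace_coe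

/-- The orthogonal projection `P_lam w` in `L²(Ω)` onto the eigenspace of `lam`. For an
orthonormal basis `φ_n` of Dirichlet eigenfunctions with eigenvalues `λ_n`, and
`w_n = ∫_Ω w φ_n dx`, this is `∑ w_n φ_n` over the `n` with `λ_n = lam`; hence
`‖P_lam w‖² = ∑ w_n²` over these `n`. -/
def eigenProj {d : ℕ} (Ω : Set (Eucl d)) (lam : ℝ) : L2 Ω →L[ℝ] L2 Ω :=
  (dirichletEigenspace Ω lam).starProjection

/-- The positive reals; on a bounded domain all Dirichlet eigenvalues are among them. -/
abbrev PosReal : Type := {lam : ℝ // 0 < lam}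

/-- The spectral space `ℍ^s(Ω)` as a linear subspace of `L²(Ω)`: those `w` that are the sum of
their eigenfunction expansion (they lie in the closed linear span of the eigenfunctions) and
satisfy `∑_n λ_n^s w_n² < ∞`. The sum is grouped by eigenvalues, so that it does not depend on a
choice of an orthonormal basis of eigenfunctions. -/
def spectralSubmodule {d : ℕ} (Ω : Set (Eucl d)) (s : Set.Ioo (0 : ℝ) 1) :
    Submodule ℝ (L2 Ω) where
  carrier := {w | w ∈ (⨆ lam : PosReal, dirichletEigenspace Ω lam).topologicalClosure ∧
    Summable fun lam : PosReal => (lam : ℝ) ^ (s : ℝ) * ‖eigenProj Ω lam w‖ ^ 2}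
  zero_mem' := ⟨Submodule.zero_mem _, by simp⟩
  add_mem' := fun {u w} hu hw => by
    refine ⟨Submodule.add_mem _ hu.1 hw.1, ?_⟩
    refine Summable.of_nonneg_of_le (fun lam => ?_) (fun lam => ?_)
      ((hu.2.add hw.2).mul_left 2)
    · have := Real.rpow_nonneg lam.2.le (s : ℝ)
      positivity
    · have h := Real.rpow_nonneg lam.2.le (s : ℝ)
      rw [map_add]
      have h1 : ‖eigenProj Ω lam u + eigenProj Ω lam w‖ ^ 2 ≤
          2 * (‖eigenProj Ω lam u‖ ^ 2 + ‖eigenProj Ω lam w‖ ^ 2) := by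
        have h2 := norm_add_le (eigenProj Ω lam u) (eigenProj Ω lam w)
        have h3 := norm_nonneg (eigenProj Ω lam u + eigenProj Ω lam w)
        nlinarith [sq_nonneg (‖eigenProj Ω lam u‖ - ‖eigenProj Ω lam w‖)]
      calc _ ≤ (lam : ℝ) ^ (s : ℝ) *
            (2 * (‖eigenProj Ω lam u‖ ^ 2 + ‖eigenProj Ω lam w‖ ^ 2)) :=
            mul_le_mul_of_nonneg_left h1 h
        _ = _ := by ring
  smul_mem' := fun a w hw => by
    refine ⟨Submodule.smul_mem _ a hw.1, ?_⟩
    refine (hw.2.mul_left (a ^ 2)).congr fun lam => ?_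
    rw [map_smul, norm_smul, mul_pow, Real.norm_eq_abs, sq_abs]
    ring

/-- The spectral fractional Sobolev space `ℍ^s(Ω)`. It is a type of its own, since it does not
carry the norm of `L²(Ω)`; its norm is the one induced by `SpecHs.innerSpec` below, that is
`‖w‖² = ∑_n λ_n^s w_n²`. -/
def SpecHs {d : ℕ} (Ω : Set (Eucl d)) (s : Set.Ioo (0 : ℝ) 1) : Type := spectralSubmodule Ω s

namespace SpecHs

variable {d : ℕ} {Ω : Set (Eucl d)} {s : Set.Ioo (0 : ℝ) 1}

instance : AddCommGroup (SpecHs Ω s) := inferInstanceAs (AddCommGroup (spectralSubmodule Ω s))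

instance : Module ℝ (SpecHs Ω s) := inferInstanceAs (Module ℝ (spectralSubmodule Ω s))

/-- The inclusion `ℍ^s(Ω) ⊆ L²(Ω)`. -/
def toL2 : SpecHs Ω s →ₗ[ℝ] L2 Ω := (spectralSubmodule Ω s).subtype

/-- The inner product `(u, w) = ∑_n λ_n^s u_n w_n`, with the sum grouped by eigenvalues. -/
def innerSpec (u w : SpecHs Ω s) : ℝ :=
  ∑' lam : PosReal,
    (lam : ℝ) ^ (s : ℝ) * inner ℝ (eigenProj Ω lam (toL2 u)) (eigenProj Ω lam (toL2 w))

theorem summable_inner (u w : SpecHs Ω s) : Summable fun lam : PosReal =>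
    (lam : ℝ) ^ (s : ℝ) *
      (inner ℝ (eigenProj Ω lam (toL2 u)) (eigenProj Ω lam (toL2 w)) : ℝ) := by
  refine Summable.of_norm_bounded (u.2.2.add w.2.2) fun lam => ?_
  have h := Real.rpow_nonneg lam.2.le (s : ℝ)
  rw [norm_mul, Real.norm_of_nonneg h, ← mul_add]
  refine mul_le_mul_of_nonneg_left ?_ h
  have h1 := norm_inner_le_norm (𝕜 := ℝ) (eigenProj Ω lam (toL2 u)) (eigenProj Ω lam (toL2 w))
  refine h1.trans ?_
  change ‖eigenProj Ω lam (toL2 u)‖ * ‖eigenProj Ω lam (toL2 w)‖ ≤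
    ‖eigenProj Ω lam (toL2 u)‖ ^ 2 + ‖eigenProj Ω lam (toL2 w)‖ ^ 2
  nlinarith [sq_nonneg (‖eigenProj Ω lam (toL2 u)‖ - ‖eigenProj Ω lam (toL2 w)‖),
    sq_nonneg ‖eigenProj Ω lam (toL2 u)‖, sq_nonneg ‖eigenProj Ω lam (toL2 w)‖]

/-- The inner product space structure of `ℍ^s(Ω)`. -/
@[reducible] def core : InnerProductSpace.Core ℝ (SpecHs Ω s) where
  inner := innerSpec
  conj_inner_symm u w := by
    simp only [conj_trivial, innerSpec, real_inner_comm]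
  re_inner_nonneg u := by
    simp only [innerSpec, RCLike.re_to_real]
    exact tsum_nonneg fun lam => mul_nonneg (Real.rpow_nonneg lam.2.le _) real_inner_self_nonneg
  add_left u v w := by
    simp only [innerSpec]
    rw [← (summable_inner u w).tsum_add (summable_inner v w)]
    refine tsum_congr fun lam => ?_
    rw [map_add, map_add, inner_add_left]
    ring
  smul_left u w a := by
    simp only [innerSpec, conj_trivial]
    rw [← tsum_mul_left]
    refine tsum_congr fun lam => ?_
    rw [map_smul, map_smul, real_inner_smul_left]
    ring
  definite u hu := by
    have hnn : ∀ lam : PosReal, 0 ≤ (lam : ℝ) ^ (s : ℝ) *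
        (inner ℝ (eigenProj Ω lam (toL2 u)) (eigenProj Ω lam (toL2 u)) : ℝ) := fun lam =>
      mul_nonneg (Real.rpow_nonneg lam.2.le _) real_inner_self_nonneg
    have hsum := (summable_inner u u).hasSum
    have htsum : ∑' lam : PosReal, (lam : ℝ) ^ (s : ℝ) *
        (inner ℝ (eigenProj Ω lam (toL2 u)) (eigenProj Ω lam (toL2 u)) : ℝ) = 0 := hu
    rw [htsum] at hsum
    have h0 := (hasSum_zero_iff_of_nonneg hnn).1 hsum
    have hP : ∀ lam : PosReal, eigenProj Ω lam (toL2 u) = 0 := fun lam => by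
      have h1 := congrFun h0 lam
      simp only [Pi.zero_apply, mul_eq_zero] at h1
      rcases h1 with h1 | h1
      · exact absurd h1 (Real.rpow_pos_of_pos lam.2 _).ne'
      · exact inner_self_eq_zero.1 h1
    have hle : (⨆ lam : PosReal, dirichletEigenspace Ω lam) ≤
        (Submodule.span ℝ {toL2 u})ᗮ := by
      refine iSup_le fun lam v hv => ?_
      rw [Submodule.mem_orthogonal_singleton_iff_inner_right]
      have h2 : toL2 u ∈ (dirichletEigenspace Ω lam)ᗮ :=
        (Submodule.starProjection_apply_eq_zero_iff _).1 (hP lam)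
      rw [real_inner_comm]
      exact h2 v hv
    have hmem := Submodule.topologicalClosure_minimal _ hle
      (Submodule.isClosed_orthogonal _) u.2.1
    exact Subtype.ext (inner_self_eq_zero.1
      ((Submodule.mem_orthogonal_singleton_iff_inner_right (𝕜 := ℝ)).1 hmem))

instance : NormedAddCommGroup (SpecHs Ω s) := core.toNormedAddCommGroup

instance : InnerProductSpace ℝ (SpecHs Ω s) := InnerProductSpace.ofCore core.toCore

end SpecHs

/-! ### The minimization problem -/

/-- `F : W → ℝ` is (sequentially) weakly lower semicontinuous, bounded below by a continuous
affine function, and continuously Fréchet differentiable. -/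
structure IsAdmissible {W : Type} [NormedAddCommGroup W] [InnerProductSpace ℝ W] (F : W → ℝ) :
    Prop where
  weakly_lsc : ∀ (u : ℕ → W) (w : W),
    Tendsto (fun k => toWeakSpace ℝ W (u k)) atTop (𝓝 (toWeakSpace ℝ W w)) →
      (F w : EReal) ≤ liminf (fun k => (F (u k) : EReal)) atTop
  bounded_below : ∃ (g : W →L[ℝ] ℝ) (c : ℝ), ∀ w, g w + c ≤ F w
  contDiff : ContDiff ℝ 1 F

/-- `|t|^0` with the convention `0^0 = 0`. -/
def absPowZero (t : ℝ) : ℝ := if t = 0 then 0 else 1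

/-- The objective `F(w) + (α/2) ‖w‖_W² + β ∫_Ω |w|^0 dx`. Here `W` is a Hilbert space of functions
and `rep w : ℝ^d → ℝ` is the function (class) that `w` stands for. -/
def objective {d : ℕ} (Ω : Set (Eucl d)) {W : Type} [NormedAddCommGroup W]
    [InnerProductSpace ℝ W] (rep : W → Eucl d → ℝ) (F : W → ℝ) (α β : ℝ) (w : W) : ℝ :=
  F w + α / 2 * ‖w‖ ^ 2 + β * ∫ x in Ω, absPowZero (rep w x)

/-- The problem `min_{w ∈ W} F(w) + (α/2) ‖w‖_W² + β ∫_Ω |w|^0 dx` has a (global) solution. -/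
def HasSolution {d : ℕ} (Ω : Set (Eucl d)) {W : Type} [NormedAddCommGroup W]
    [InnerProductSpace ℝ W] (rep : W → Eucl d → ℝ) (F : W → ℝ) (α β : ℝ) : Prop :=
  ∃ w : W, ∀ v : W, objective Ω rep F α β w ≤ objective Ω rep F α β v

end FracSob

end

open FracSob

noncomputable section

namespace FracSob

/-! ### Weak compactness and existence of minimizers in Hilbert spaces -/

/-! The proof is the direct method. The quadratic term beats the affine lower bound, so a minimizing
sequence is bounded and has a weakly convergent subsequence; `F` and the norm are weakly lower
semicontinuous (`IsAdmissible.exists_minimizer`). The term with `absPowZero` need not be lower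
semicontinuous for weak `L²` convergence, but it is for a.e. convergence: where the limit is
nonzero, the sequence is eventually nonzero. Hence it suffices that bounded, weakly convergent
sequences of `W` converge in measure on `Ω` (`hasSolution_of_tendstoInMeasure`), since a subsequence
then converges a.e.

Convergence in measure needs control only away from the boundary, because a thin layer of `Ω` along
its boundary has small measure. At the remaining points a function differs from its mean over a ball
of radius `h` by at most its mean oscillation there. The means of the differences tend to zero by
weak convergence, tested against indicators of balls, so only a bound on the oscillation, uniform
along the sequence, is missing (`tendstoInMeasure_zero_of_oscillation`).

In `H^s` the seminorm bounds the oscillation by a multiple of `h ^ s`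
(`lintegral_oscillation_le_of_diffQuotient`). In the spectral space the bound comes from `L²`
translations: the eigenfunction expansion is cut at a level `Lam`, the low part has gradient of size
at most `√Lam` times its `L²` norm, and the high part has `L²` norm of order `Lam ^ (-s/2)`
(`SpecHs.norm_translationSub_le`). Eigenfunctions are handled as pairs `(w, ∇w)` in the closure of
the graph of the gradient on test functions (`gradGraph`, `eigenGraph`). A Poincaré inequality
bounds the eigenvalues below, which gives the embedding into `L²(Ω)` and completeness. -/

/-- Bounded sequences in a Hilbert space have weakly convergent subsequences. -/
theorem exists_weakly_convergent_subseq {W : Type*} [NormedAddCommGroup W]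
    [InnerProductSpace ℝ W] [CompleteSpace W] {u : ℕ → W} {M : ℝ} (hu : ∀ k, ‖u k‖ ≤ M) :
    ∃ (w : W) (φ : ℕ → ℕ), StrictMono φ ∧
      ∀ v, Tendsto (fun k => inner ℝ (u (φ k)) v) atTop (𝓝 (inner ℝ w v)) := by
  -- Sequential compactness of the dual ball needs separability, so the argument runs in the closed
  -- span of the sequence.
  set V : Submodule ℝ W := (Submodule.span ℝ (Set.range u)).topologicalClosure with hV
  have hsep : TopologicalSpace.IsSeparable (V : Set W) := by
    rw [hV, Submodule.topologicalClosure_coe]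
    exact ((Set.countable_range u).isSeparable.span (R := ℝ)).closure
  have : TopologicalSpace.SeparableSpace V := hsep.separableSpace
  have : CompleteSpace V := (Submodule.isClosed_topologicalClosure _).completeSpace_coe
  have huV : ∀ k, u k ∈ V := fun k =>
    Submodule.le_topologicalClosure _ (Submodule.subset_span (Set.mem_range_self k))
  let f : ℕ → WeakDual ℝ V := fun k =>
    StrongDual.toWeakDual (InnerProductSpace.toDual ℝ V ⟨u k, huV k⟩)
  have hf : ∀ k, f k ∈ WeakDual.toStrongDual ⁻¹' Metric.closedBall (0 : StrongDual ℝ V) M := by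
    intro k
    change (InnerProductSpace.toDual ℝ V ⟨u k, huV k⟩) ∈ Metric.closedBall (0 : StrongDual ℝ V) M
    rw [mem_closedBall_zero_iff, LinearIsometryEquiv.norm_map]
    exact hu k
  obtain ⟨g, -, φ, hφ, hlim⟩ := WeakDual.isSeqCompact_closedBall ℝ V 0 M hf
  refine ⟨((InnerProductSpace.toDual ℝ V).symm (WeakDual.toStrongDual g) : V), φ, hφ, fun v => ?_⟩
  -- Against vectors of `V`, a test vector of `W` acts through its projection onto `V`, so weak
  -- convergence in `V` gives it in `W`.
  have h1 : ∀ x : V, inner ℝ (x : W) v = inner ℝ x (V.orthogonalProjectionOnto v) := by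
    intro x
    rw [← Submodule.inner_orthogonalProjectionOnto_eq_of_mem_left x v]
  have h2 := ((WeakDual.eval_continuous (V.orthogonalProjectionOnto v)).tendsto g).comp hlim
  simp only [h1, InnerProductSpace.toDual_symm_apply]
  refine h2.congr fun k => ?_
  exact (h1 ⟨u (φ k), huV _⟩).symm

/-- By Riesz representation inner products exhaust the continuous functionals. This supplies the
form of convergence required by `IsAdmissible.weakly_lsc`. -/
theorem tendsto_toWeakSpace_of_forall_inner {W : Type*} [NormedAddCommGroup W]
    [InnerProductSpace ℝ W] [CompleteSpace W] {u : ℕ → W} {w : W}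
    (h : ∀ v, Tendsto (fun k => inner ℝ (u k) v) atTop (𝓝 (inner ℝ w v))) :
    Tendsto (fun k => toWeakSpace ℝ W (u k)) atTop (𝓝 (toWeakSpace ℝ W w)) := by
  refine (WeakBilin.tendsto_iff_forall_eval_tendsto (topDualPairing ℝ W).flip ?_).2 fun l => ?_
  · intro x y hxy
    refine ext_inner_right ℝ fun v => ?_
    have := congrArg (fun l => l (InnerProductSpace.toDual ℝ W v)) hxy
    simpa [real_inner_comm] using this
  · obtain ⟨v, rfl⟩ := (InnerProductSpace.toDual ℝ W).surjective l
    have := h v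
    simp only [fun x => real_inner_comm v x] at this
    exact this

/-- The norm is weakly sequentially lower semicontinuous. -/
theorem eventually_norm_sq_lt_of_weak {W : Type*} [NormedAddCommGroup W]
    [InnerProductSpace ℝ W] {u : ℕ → W} {w : W}
    (h : ∀ v, Tendsto (fun k => inner ℝ (u k) v) atTop (𝓝 (inner ℝ w v))) {ε : ℝ} (hε : 0 < ε) :
    ∀ᶠ k in atTop, ‖w‖ ^ 2 - ε < ‖u k‖ ^ 2 := by
  -- Expanding `0 ≤ ‖u k - w‖ ^ 2` bounds `‖u k‖ ^ 2` below by this expression, which is affine in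
  -- `u k`.
  have h1 : Tendsto (fun k => 2 * inner ℝ (u k) w - ‖w‖ ^ 2) atTop (𝓝 (‖w‖ ^ 2)) := by
    have := ((h w).const_mul 2).sub_const (‖w‖ ^ 2)
    rwa [real_inner_self_eq_norm_sq, two_mul, add_sub_cancel_right] at this
  filter_upwards [h1.eventually_const_lt (sub_lt_self _ hε)] with k hk
  have := norm_sub_sq_real (u k) w
  nlinarith [sq_nonneg ‖u k - w‖]

/-- The direct method: a weakly lower semicontinuous coercive problem has a minimizer. -/
theorem IsAdmissible.exists_minimizer {W : Type} [NormedAddCommGroup W] [InnerProductSpace ℝ W]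
    [CompleteSpace W] {F : W → ℝ} (hF : IsAdmissible F) {α : ℝ} (hα : 0 < α) {N : W → ℝ}
    (hN0 : ∀ w, 0 ≤ N w)
    (hN : ∀ (u : ℕ → W) (w : W) (M : ℝ), (∀ k, ‖u k‖ ≤ M) →
      (∀ v, Tendsto (fun k => inner ℝ (u k) v) atTop (𝓝 (inner ℝ w v))) →
      ∃ φ : ℕ → ℕ, StrictMono φ ∧ ∀ ε > 0, ∀ᶠ k in atTop, N w - ε < N (u (φ k))) :
    ∃ w, ∀ v, F w + α / 2 * ‖w‖ ^ 2 + N w ≤ F v + α / 2 * ‖v‖ ^ 2 + N v := by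
  obtain ⟨g, c, hg⟩ := hF.bounded_below
  set J : W → ℝ := fun w => F w + α / 2 * ‖w‖ ^ 2 + N w with hJ
  -- Coercivity: Young's inequality absorbs the linear functional into half of the quadratic term,
  -- leaving `α / 4`.
  have hJ1 : ∀ w, c - ‖g‖ ^ 2 / α + α / 4 * ‖w‖ ^ 2 ≤ J w := by
    intro w
    have h1 := hg w
    have h2 := neg_le_of_abs_le (g.le_opNorm w)
    have h3 : ‖g‖ * ‖w‖ ≤ ‖g‖ ^ 2 / α + α / 4 * ‖w‖ ^ 2 := by
      have : ‖g‖ ^ 2 / α + α / 4 * ‖w‖ ^ 2 - ‖g‖ * ‖w‖ = (‖g‖ - α / 2 * ‖w‖) ^ 2 / α := by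
        field_simp
        ring
      have h4 : 0 ≤ (‖g‖ - α / 2 * ‖w‖) ^ 2 / α := by positivity
      linarith
    have := hN0 w
    simp only [hJ]
    linarith
  have hbdd : BddBelow (Set.range J) := by
    refine ⟨c - ‖g‖ ^ 2 / α, ?_⟩
    rintro _ ⟨w, rfl⟩
    have : 0 ≤ α / 4 * ‖w‖ ^ 2 := by positivity
    linarith [hJ1 w]
  set m := sInf (Set.range J) with hm
  have hex : ∀ k : ℕ, ∃ w, J w < m + 1 / ((k : ℝ) + 1) := by
    intro k
    obtain ⟨_, ⟨w, rfl⟩, hw⟩ := exists_lt_of_csInf_lt (Set.range_nonempty J)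
      (lt_add_of_pos_right m (Nat.one_div_pos_of_nat (n := k)))
    exact ⟨w, hw⟩
  choose u hu using hex
  have hbound : ∀ k, ‖u k‖ ≤ √(4 / α * (m + 1 - c + ‖g‖ ^ 2 / α)) := by
    intro k
    refine Real.le_sqrt_of_sq_le ?_
    have h1 := hJ1 (u k)
    have h2 := hu k
    have h3 : 1 / ((k : ℝ) + 1) ≤ 1 := by
      rw [div_le_one (by positivity)]
      have : (0 : ℝ) ≤ k := by positivity
      linarith
    rw [div_mul_eq_mul_div, le_div_iff₀ hα]
    linarith
  obtain ⟨w, φ, hφ, hw⟩ := exists_weakly_convergent_subseq hbound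
  obtain ⟨ψ, hψ, hψN⟩ := hN _ w _ (fun k => hbound (φ k)) hw
  have hw' : ∀ v, Tendsto (fun k => inner ℝ (u (φ (ψ k))) v) atTop (𝓝 (inner ℝ w v)) :=
    fun v => (hw v).comp hψ.tendsto_atTop
  have hFl := hF.weakly_lsc _ w (tendsto_toWeakSpace_of_forall_inner hw')
  refine ⟨w, fun v => ?_⟩
  refine le_trans (b := m) ?_ (csInf_le hbdd ⟨v, rfl⟩)
  refine le_of_forall_pos_le_add fun ε hε => ?_
  -- The losses are `δ` each from `F`, `N` and the minimizing sequence, and `α / 2 * δ` from the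
  -- norm; their sum is below `(3 + α) * δ = ε`.
  set δ := ε / (3 + α) with hδ
  have hδ0 : 0 < δ := by positivity
  have e1 : ∀ᶠ k in atTop, F w - δ < F (u (φ (ψ k))) := by
    have : ((F w - δ : ℝ) : EReal) < liminf (fun k => (F (u (φ (ψ k))) : EReal)) atTop :=
      lt_of_lt_of_le (EReal.coe_lt_coe_iff.2 (by linarith)) hFl
    filter_upwards [eventually_lt_of_lt_liminf this] with k hk
    exact EReal.coe_lt_coe_iff.1 hk
  have e2 := eventually_norm_sq_lt_of_weak hw' hδ0
  have e3 := hψN δ hδ0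
  have e4 : ∀ᶠ k : ℕ in atTop, 1 / (((φ (ψ k) : ℕ) : ℝ) + 1) < δ :=
    ((tendsto_one_div_add_atTop_nhds_zero_nat (𝕜 := ℝ)).comp
      ((hφ.comp hψ).tendsto_atTop)).eventually_lt_const hδ0
  obtain ⟨k, h1, h2, h3, h4⟩ := (e1.and (e2.and (e3.and e4))).exists
  have h5 := hu (φ (ψ k))
  simp only [hJ] at h5
  have h6 : δ * (3 + α) = ε := by rw [hδ]; field_simp
  nlinarith

/-! ### Lower semicontinuity of the measure of the support -/

theorem absPowZero_nonneg (t : ℝ) : 0 ≤ absPowZero t := by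
  unfold absPowZero; split_ifs <;> simp

theorem absPowZero_le_one (t : ℝ) : absPowZero t ≤ 1 := by
  unfold absPowZero; split_ifs <;> simp

theorem measurable_absPowZero : Measurable absPowZero :=
  Measurable.ite (measurableSet_singleton 0) measurable_const measurable_const

theorem integrable_absPowZero {X : Type*} [MeasurableSpace X] {μ : Measure X} [IsFiniteMeasure μ]
    {f : X → ℝ} (hf : AEStronglyMeasurable f μ) : Integrable (fun x => absPowZero (f x)) μ := by
  refine (integrable_const (1 : ℝ)).mono'
    (measurable_absPowZero.comp_aemeasurable hf.aemeasurable).aestronglyMeasurable ?_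
  refine Eventually.of_forall fun x => ?_
  rw [Real.norm_of_nonneg (absPowZero_nonneg _)]
  exact absPowZero_le_one _

/-- Truncating by `absPowZero (g x)` turns lower semicontinuity into convergence: the minimum is `0`
where `g` vanishes and eventually `1` elsewhere, so dominated convergence applies. -/
theorem eventually_integral_absPowZero_lt {X : Type*} [MeasurableSpace X] {μ : Measure X}
    [IsFiniteMeasure μ] {f : ℕ → X → ℝ} {g : X → ℝ} (hf : ∀ k, AEStronglyMeasurable (f k) μ)
    (hg : AEStronglyMeasurable g μ) (h : ∀ᵐ x ∂μ, Tendsto (fun k => f k x) atTop (𝓝 (g x)))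
    {ε : ℝ} (hε : 0 < ε) :
    ∀ᶠ k in atTop, ∫ x, absPowZero (g x) ∂μ - ε < ∫ x, absPowZero (f k x) ∂μ := by
  have h1 : Tendsto (fun k => ∫ x, min (absPowZero (f k x)) (absPowZero (g x)) ∂μ) atTop
      (𝓝 (∫ x, absPowZero (g x) ∂μ)) := by
    refine tendsto_integral_of_dominated_convergence (fun _ => 1) (fun k => ?_)
      (integrable_const _) (fun k => ?_) ?_
    · exact ((integrable_absPowZero (hf k)).inf (integrable_absPowZero hg)).aestronglyMeasurable
    · refine Eventually.of_forall fun x => ?_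
      rw [Real.norm_of_nonneg (le_min (absPowZero_nonneg _) (absPowZero_nonneg _))]
      exact (min_le_right _ _).trans (absPowZero_le_one _)
    · filter_upwards [h] with x hx
      refine tendsto_const_nhds.congr' ?_
      by_cases h0 : g x = 0
      · refine Eventually.of_forall fun k => ?_
        simp [h0, absPowZero]
        split_ifs <;> simp
      · filter_upwards [hx.eventually_ne h0] with k hk
        simp [absPowZero, h0, hk]
  filter_upwards [h1.eventually_const_lt (sub_lt_self _ hε)] with k hk
  refine hk.trans_le (integral_mono ?_ (integrable_absPowZero (hf k)) fun x => min_le_left _ _)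
  exact (integrable_absPowZero (hf k)).inf (integrable_absPowZero hg)

/-- Existence of solutions, given that weak convergence implies convergence in measure on `Ω`. -/
theorem hasSolution_of_tendstoInMeasure {d : ℕ} {Ω : Set (Eucl d)} (hΩ : volume Ω < ⊤) {W : Type}
    [NormedAddCommGroup W] [InnerProductSpace ℝ W] [CompleteSpace W] {rep : W → Eucl d → ℝ}
    (hrep : ∀ w, Measurable (rep w))
    (hconv : ∀ (u : ℕ → W) (w : W) (M : ℝ), (∀ k, ‖u k‖ ≤ M) →
      (∀ v, Tendsto (fun k => inner ℝ (u k) v) atTop (𝓝 (inner ℝ w v))) →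
      TendstoInMeasure (volume.restrict Ω) (fun k => rep (u k)) atTop (rep w))
    {F : W → ℝ} (hF : IsAdmissible F) {α β : ℝ} (hα : 0 < α) (hβ : 0 < β) :
    HasSolution Ω rep F α β := by
  have : IsFiniteMeasure (volume.restrict Ω) := ⟨by simpa using hΩ⟩
  refine hF.exists_minimizer hα (N := fun w => β * ∫ x in Ω, absPowZero (rep w x))
    (fun w => mul_nonneg hβ.le (integral_nonneg fun x => absPowZero_nonneg _)) ?_
  intro u w M hM hu
  obtain ⟨φ, hφ, hae⟩ := (hconv u w M hM hu).exists_seq_tendsto_ae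
  refine ⟨φ, hφ, fun ε hε => ?_⟩
  filter_upwards [eventually_integral_absPowZero_lt
    (fun k => (hrep (u (φ k))).aestronglyMeasurable) (hrep w).aestronglyMeasurable hae
    (div_pos hε hβ)] with k hk
  have := mul_lt_mul_of_pos_left hk hβ
  rwa [mul_sub, mul_div_cancel₀ _ hβ.ne'] at this

/-! ### Compactness in measure from small local oscillation -/

theorem ball_subset_of_notMem_thickening {X : Type*} [PseudoMetricSpace X] {Ω : Set X} {x : X}
    {h : ℝ} (hx : x ∉ Metric.thickening h Ωᶜ) : Metric.ball x h ⊆ Ω := by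
  intro y hy
  by_contra hyΩ
  exact hx (Metric.mem_thickening_iff.2 ⟨y, hyΩ, by rwa [dist_comm, ← Metric.mem_ball]⟩)

/-- The moving ball is a slice of the open set `dist z.2 z.1 < h` in the product, so the inner
integral is a partial integral of one jointly measurable function. -/
theorem measurable_lintegral_ball {d : ℕ} {g : Eucl d × Eucl d → ℝ≥0∞} (hg : Measurable g)
    (h : ℝ) : Measurable fun x => ∫⁻ y in Metric.ball x h, g (x, y) := by
  have hs : MeasurableSet {z : Eucl d × Eucl d | dist z.2 z.1 < h} :=
    measurableSet_lt (measurable_snd.dist measurable_fst) measurable_const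
  have h1 := (hg.indicator hs).lintegral_prod_right' (ν := (volume : Measure (Eucl d)))
  convert h1 using 2 with x
  rw [← lintegral_indicator Metric.isOpen_ball.measurableSet]
  rfl

theorem measurable_integral_ball {d : ℕ} {f : Eucl d → ℝ} (hf : Measurable f) (h : ℝ) :
    Measurable fun x => ∫ y in Metric.ball x h, f y := by
  have hs : MeasurableSet {z : Eucl d × Eucl d | dist z.2 z.1 < h} :=
    measurableSet_lt (measurable_snd.dist measurable_fst) measurable_const
  have h1 := (((hf.comp measurable_snd).indicator hs).stronglyMeasurable).integral_prod_right'
    (ν := (volume : Measure (Eucl d)))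
  convert h1.measurable using 2 with x
  rw [← integral_indicator Metric.isOpen_ball.measurableSet]
  rfl

/-- Integrating `f x = (f x - f y) + f y` over `y` in the ball separates oscillation from average.
-/
theorem enorm_mul_volume_ball_le {d : ℕ} {f : Eucl d → ℝ} {x : Eucl d} {h : ℝ}
    (hf : IntegrableOn f (Metric.ball x h)) :
    ‖f x‖ₑ * volume (Metric.ball (0 : Eucl d) h) ≤
      (∫⁻ y in Metric.ball x h, ‖f x - f y‖ₑ) + ‖∫ y in Metric.ball x h, f y‖ₑ := by
  have hfin : volume (Metric.ball x h) ≠ ⊤ := measure_ball_lt_top.ne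
  have h1 : ∫ y in Metric.ball x h, (f x - f y) =
      volume.real (Metric.ball x h) * f x - ∫ y in Metric.ball x h, f y := by
    have hc : IntegrableOn (fun _ => f x) (Metric.ball x h) := integrableOn_const hfin
    rw [integral_sub hc hf]
    simp
  have h2 : volume.real (Metric.ball x h) * f x =
      (∫ y in Metric.ball x h, (f x - f y)) + ∫ y in Metric.ball x h, f y := by
    rw [h1]; ring
  have h3 : ‖f x‖ₑ * volume (Metric.ball (0 : Eucl d) h) =
      ‖volume.real (Metric.ball x h) * f x‖ₑ := by
    rw [enorm_mul, mul_comm, ← Measure.addHaar_ball_center volume x h, measureReal_def,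
      Real.enorm_eq_ofReal ENNReal.toReal_nonneg, ENNReal.ofReal_toReal hfin]
  rw [h3, h2]
  exact (enorm_add_le _ _).trans (by gcongr; exact enorm_integral_le_lintegral_enorm _)

/-- A sequence whose averages over small balls converge to zero, and whose mean oscillation over
small balls is small uniformly along the sequence, converges to zero in measure. -/
theorem tendstoInMeasure_zero_of_oscillation {d : ℕ} {Ω : Set (Eucl d)} (hΩo : IsOpen Ω)
    (hΩf : volume Ω < ⊤) {w : ℕ → Eucl d → ℝ} (hm : ∀ k, Measurable (w k))
    (hi : ∀ k, IntegrableOn (w k) Ω)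
    (havg : ∀ x h, Metric.ball x h ⊆ Ω →
      Tendsto (fun k => ∫ y in Metric.ball x h, w k y) atTop (𝓝 0))
    (hosc : ∀ η : ℝ≥0∞, η ≠ 0 → ∀ᶠ h in 𝓝[>] (0 : ℝ), ∀ k,
      ∫⁻ x in (Metric.thickening h Ωᶜ)ᶜ, ∫⁻ y in Metric.ball x h, ‖w k x - w k y‖ₑ ≤
        η * volume (Metric.ball (0 : Eucl d) h)) :
    TendstoInMeasure (volume.restrict Ω) w atTop 0 := by
  rw [tendstoInMeasure_iff_enorm]
  intro ε hε hεt
  have hfin : IsFiniteMeasure (volume.restrict Ω) := ⟨by simpa using hΩf⟩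
  rw [ENNReal.tendsto_nhds_zero]
  intro δ hδ
  have hδ3 : δ / 3 ≠ 0 := by simp [hδ.ne']
  have hε2 : ε / 2 ≠ 0 := by simp [hε.ne']
  have hε2t : ε / 2 ≠ ⊤ := ENNReal.div_ne_top hεt (by simp)
  -- The thickenings shrink to the closed set `Ωᶜ`, which is null for the measure restricted to `Ω`.
  have hth : Tendsto (fun r => volume.restrict Ω (Metric.thickening r Ωᶜ)) (𝓝[>] 0) (𝓝 0) := by
    have h1 := tendsto_measure_thickening_of_isClosed (μ := volume.restrict Ω)
      ⟨1, one_pos, measure_ne_top _ _⟩ hΩo.isClosed_compl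
    rwa [Measure.restrict_apply hΩo.isClosed_compl.measurableSet, Set.compl_inter_self,
      measure_empty] at h1
  -- One radius serves all `k`: the boundary layer has measure at most `δ / 3`, and the oscillation
  -- bound `δ / 3 * (ε / 2)` is what Markov's inequality needs at threshold `ε / 2 * b`.
  obtain ⟨h, hh1, hh2, hh0⟩ := ((ENNReal.tendsto_nhds_zero.1 hth (δ / 3) (pos_iff_ne_zero.2 hδ3)).and
    ((hosc (δ / 3 * (ε / 2)) (mul_ne_zero hδ3 hε2)).and self_mem_nhdsWithin)).exists
  replace hh0 : 0 < h := hh0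
  set K : Set (Eucl d) := (Metric.thickening h Ωᶜ)ᶜ with hK
  have hKm : MeasurableSet K := Metric.isOpen_thickening.measurableSet.compl
  have hKΩ : K ⊆ Ω := fun x hx =>
    ball_subset_of_notMem_thickening hx (Metric.mem_ball_self hh0)
  set b := volume (Metric.ball (0 : Eucl d) h) with hb
  have hb0 : b ≠ 0 := (Metric.measure_ball_pos _ _ hh0).ne'
  have hbt : b ≠ ⊤ := measure_ball_lt_top.ne
  have hKf : IsFiniteMeasure (volume.restrict K) :=
    ⟨by simpa using (measure_mono hKΩ).trans_lt hΩf⟩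
  have hS : TendstoInMeasure (volume.restrict K) (fun k x => ∫ y in Metric.ball x h, w k y) atTop
      0 := by
    refine tendstoInMeasure_of_tendsto_ae
      (fun k => (measurable_integral_ball (hm k) h).aestronglyMeasurable) ?_
    filter_upwards [ae_restrict_mem hKm] with x hx
    exact havg x h (ball_subset_of_notMem_thickening hx)
  rw [tendstoInMeasure_iff_enorm] at hS
  have hS' := ENNReal.tendsto_nhds_zero.1
    (hS (ε / 2 * b) (pos_iff_ne_zero.2 (mul_ne_zero hε2 hb0)) (ENNReal.mul_ne_top hε2t hbt))
    (δ / 3) (pos_iff_ne_zero.2 hδ3)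
  filter_upwards [hS'] with k hk
  simp only [Pi.zero_apply, sub_zero] at hk ⊢
  set R : Eucl d → ℝ≥0∞ := fun x => ∫⁻ y in Metric.ball x h, ‖w k x - w k y‖ₑ with hR
  have hRm : Measurable R := measurable_lintegral_ball
    (g := fun z => ‖w k z.1 - w k z.2‖ₑ)
    (((hm k).comp measurable_fst).sub ((hm k).comp measurable_snd)).enorm h
  have hR2 : volume.restrict K {x | ε / 2 * b ≤ R x} ≤ δ / 3 := by
    refine (meas_ge_le_lintegral_div hRm.aemeasurable (mul_ne_zero hε2 hb0)
      (ENNReal.mul_ne_top hε2t hbt)).trans ?_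
    refine ENNReal.div_le_of_le_mul ?_
    rw [← mul_assoc]
    exact hh2 k
  -- If `|w k x| ≥ ε` at a point of `K`, then the oscillation or the integral over the ball must
  -- reach half of `ε * b`.
  have hsub : {x | ε ≤ ‖w k x‖ₑ} ∩ Ω ⊆ (Metric.thickening h Ωᶜ ∩ Ω) ∪
      (({x | ε / 2 * b ≤ R x} ∩ K) ∪
        ({x | ε / 2 * b ≤ ‖∫ y in Metric.ball x h, w k y‖ₑ} ∩ K)) := by
    rintro x ⟨hx, hxΩ⟩
    by_cases hxK : x ∈ K
    · right
      have h1 := enorm_mul_volume_ball_le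
        ((hi k).mono_set (ball_subset_of_notMem_thickening hxK))
      by_contra! hcon
      simp only [Set.mem_union, Set.mem_inter_iff, hxK, and_true, Set.mem_ofPred_eq, not_or,
        not_le] at hcon
      have h2 := ENNReal.add_lt_add hcon.1 hcon.2
      rw [← add_mul, ENNReal.add_halves] at h2
      exact absurd ((mul_le_mul_left hx b).trans h1) (not_le.2 h2)
    · exact Or.inl ⟨not_not.1 hxK, hxΩ⟩
  have hA : MeasurableSet {x | ε ≤ ‖w k x‖ₑ} := measurableSet_le measurable_const (hm k).enorm
  rw [Measure.restrict_apply hA]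
  refine (measure_mono hsub).trans ((measure_union_le _ _).trans ?_)
  rw [← Measure.restrict_apply Metric.isOpen_thickening.measurableSet]
  calc _ ≤ δ / 3 + (δ / 3 + δ / 3) := by
        refine add_le_add hh1 ((measure_union_le _ _).trans (add_le_add ?_ ?_))
        · rwa [← Measure.restrict_apply (measurableSet_le measurable_const hRm)]
        · rwa [← Measure.restrict_apply (measurableSet_le measurable_const
            (measurable_integral_ball (hm k) h).enorm)]
    _ = δ := by rw [← add_assoc, ENNReal.add_thirds]

/-- Translations that are uniformly small in `L¹` bound the mean oscillation. -/
theorem lintegral_oscillation_le_of_translation {d : ℕ} {Ω : Set (Eucl d)} {w : Eucl d → ℝ}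
    (hm : Measurable w) {h : ℝ} {η : ℝ≥0∞} (hη : ∀ z ∈ Metric.ball (0 : Eucl d) h,
      ∫⁻ x in Ω, ‖Ω.indicator w (x + z) - Ω.indicator w x‖ₑ ≤ η) (hΩ : MeasurableSet Ω)
      (hh : 0 < h) :
    ∫⁻ x in (Metric.thickening h Ωᶜ)ᶜ, ∫⁻ y in Metric.ball x h, ‖w x - w y‖ₑ ≤
      η * volume (Metric.ball (0 : Eucl d) h) := by
  have hKm : MeasurableSet (Metric.thickening h Ωᶜ)ᶜ :=
    Metric.isOpen_thickening.measurableSet.compl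
  have hKΩ : (Metric.thickening h Ωᶜ)ᶜ ⊆ Ω := fun x hx =>
    ball_subset_of_notMem_thickening hx (Metric.mem_ball_self hh)
  set v := Ω.indicator w with hv
  have hvm : Measurable v := hm.indicator hΩ
  -- After substituting `y = x + z`, both points lie in `Ω`, so the extension by zero is invisible.
  have h1 : ∀ x ∈ (Metric.thickening h Ωᶜ)ᶜ, ∫⁻ y in Metric.ball x h, ‖w x - w y‖ₑ =
      ∫⁻ z in Metric.ball (0 : Eucl d) h, ‖v (x + z) - v x‖ₑ := by
    intro x hx
    rw [← (measurePreserving_add_left volume x).setLIntegral_comp_preimage_emb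
      (MeasurableEquiv.addLeft x).measurableEmbedding]
    rw [preimage_add_ball, sub_self]
    refine setLIntegral_congr_fun Metric.isOpen_ball.measurableSet fun z hz => ?_
    have hz' : x + z ∈ Ω := ball_subset_of_notMem_thickening hx (by simpa using hz)
    rw [hv, Set.indicator_of_mem hz', Set.indicator_of_mem (hKΩ hx), enorm_sub_rev]
  rw [setLIntegral_congr_fun hKm h1]
  calc _ ≤ ∫⁻ x in Ω, ∫⁻ z in Metric.ball (0 : Eucl d) h, ‖v (x + z) - v x‖ₑ :=
        lintegral_mono_set hKΩ
    _ = ∫⁻ z in Metric.ball (0 : Eucl d) h, ∫⁻ x in Ω, ‖v (x + z) - v x‖ₑ :=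
        lintegral_lintegral_swap (((hvm.comp (measurable_fst.add measurable_snd)).sub
          (hvm.comp measurable_fst)).enorm.aemeasurable)
    _ ≤ ∫⁻ z in Metric.ball (0 : Eucl d) h, η :=
        setLIntegral_mono measurable_const hη
    _ = _ := by rw [setLIntegral_const]

/-- The mean oscillation over small balls is bounded by the `H^s`-seminorm. -/
theorem lintegral_oscillation_le_of_diffQuotient {d : ℕ} {Ω : Set (Eucl d)} {w : Eucl d → ℝ}
    (hm : Measurable w) {s : ℝ} (hs : 0 < s) {h : ℝ} (hh : 0 < h) :
    ∫⁻ x in (Metric.thickening h Ωᶜ)ᶜ, ∫⁻ y in Metric.ball x h, ‖w x - w y‖ₑ ≤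
      ENNReal.ofReal (h ^ s) * (volume Ω + (volume (Metric.ball (0 : Eucl d) 1))⁻¹ *
        ∫⁻ z, ‖diffQuotient s w z‖ₑ ^ 2 ∂(prodVolume Ω)) *
          volume (Metric.ball (0 : Eucl d) h) := by
  have hKm : MeasurableSet (Metric.thickening h Ωᶜ)ᶜ :=
    Metric.isOpen_thickening.measurableSet.compl
  have hKΩ : (Metric.thickening h Ωᶜ)ᶜ ⊆ Ω := fun x hx =>
    ball_subset_of_notMem_thickening hx (Metric.mem_ball_self hh)
  have hqm : Measurable (diffQuotient s w) := by
    unfold diffQuotient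
    fun_prop
  -- With `q` the difference quotient, `|w x - w y|` is at most `h ^ s * (h ^ (d/2) * |q|)`, and `t
  -- ≤ 1 + t ^ 2` makes the second factor quadratic in `q`.
  have hpt : ∀ x, ∀ y ∈ Metric.ball x h, ‖w x - w y‖ₑ ≤ ENNReal.ofReal (h ^ s) +
      ENNReal.ofReal (h ^ (d + s)) * ‖diffQuotient s w (x, y)‖ₑ ^ 2 := by
    intro x y hy
    rw [Metric.mem_ball, dist_comm, dist_eq_norm] at hy
    set q := diffQuotient s w (x, y) with hq
    have h1 : |w x - w y| ≤ h ^ s + h ^ (d + s) * q ^ 2 := by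
      rcases eq_or_ne x y with rfl | hxy
      · simp only [sub_self, abs_zero]
        positivity
      · have h2 : 0 < ‖x - y‖ := norm_pos_iff.2 (sub_ne_zero.2 hxy)
        have h3 : w x - w y = ‖x - y‖ ^ ((d : ℝ) / 2 + s) * q := by
          rw [hq, diffQuotient]
          field_simp
        have h4 : ‖x - y‖ ^ ((d : ℝ) / 2 + s) ≤ h ^ s * h ^ ((d : ℝ) / 2) := by
          rw [← Real.rpow_add hh, add_comm]
          exact Real.rpow_le_rpow h2.le hy.le (by positivity)
        have h5 : h ^ (d + s) = h ^ s * (h ^ ((d : ℝ) / 2) * h ^ ((d : ℝ) / 2)) := by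
          rw [← Real.rpow_add hh, ← Real.rpow_add hh]
          congr 1
          ring
        rw [h3, abs_mul, abs_of_nonneg (by positivity), h5]
        calc _ ≤ h ^ s * h ^ ((d : ℝ) / 2) * |q| := by gcongr
          _ ≤ h ^ s * (1 + (h ^ ((d : ℝ) / 2) * |q|) ^ 2) := by
            rw [mul_assoc]
            gcongr
            nlinarith [sq_nonneg (h ^ ((d : ℝ) / 2) * |q| - 1)]
          _ = _ := by
            rw [mul_pow, sq_abs]
            ring
    rw [← Real.norm_eq_abs] at h1
    rw [← ofReal_norm, ← ofReal_norm, ← ENNReal.ofReal_pow (norm_nonneg _),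
      ← ENNReal.ofReal_mul (by positivity), ← ENNReal.ofReal_add (by positivity) (by positivity)]
    refine ENNReal.ofReal_le_ofReal ?_
    rwa [Real.norm_eq_abs q, sq_abs]
  -- Scaling of balls trades `h ^ d` for the volume of the ball of radius `h`, so that volume
  -- factors out of both terms.
  have hball : ENNReal.ofReal (h ^ (d + s)) = ENNReal.ofReal (h ^ s) *
      (volume (Metric.ball (0 : Eucl d) 1))⁻¹ * volume (Metric.ball (0 : Eucl d) h) := by
    rw [Measure.addHaar_ball_of_pos volume (0 : Eucl d) hh, finrank_euclideanSpace_fin, mul_assoc,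
      mul_left_comm _ (ENNReal.ofReal (h ^ d)),
      ENNReal.inv_mul_cancel (Metric.measure_ball_pos _ _ one_pos).ne' measure_ball_lt_top.ne,
      mul_one, ← ENNReal.ofReal_mul (by positivity), add_comm, Real.rpow_add hh, Real.rpow_natCast]
  have hin : ∀ x ∈ (Metric.thickening h Ωᶜ)ᶜ, ∫⁻ y in Metric.ball x h, ‖w x - w y‖ₑ ≤
      ENNReal.ofReal (h ^ s) * volume (Metric.ball (0 : Eucl d) h) +
        ENNReal.ofReal (h ^ (d + s)) * ∫⁻ y in Ω, ‖diffQuotient s w (x, y)‖ₑ ^ 2 := by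
    intro x hx
    have hq2 : Measurable fun y => ‖diffQuotient s w (x, y)‖ₑ ^ 2 :=
      ((hqm.comp measurable_prodMk_left).enorm.pow_const 2)
    refine (setLIntegral_mono (measurable_const.fun_add (hq2.const_mul _)) (hpt x)).trans ?_
    rw [lintegral_add_left measurable_const, setLIntegral_const,
      Measure.addHaar_ball_center volume x h, lintegral_const_mul _ hq2]
    gcongr
    exact ball_subset_of_notMem_thickening hx
  have hq3 : Measurable fun x => ∫⁻ y in Ω, ‖diffQuotient s w (x, y)‖ₑ ^ 2 :=
    (hqm.enorm.pow_const 2).lintegral_prod_right'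
  refine (setLIntegral_mono (measurable_const.fun_add (hq3.const_mul _)) hin).trans ?_
  refine (lintegral_mono_set hKΩ).trans ?_
  rw [lintegral_add_left measurable_const, setLIntegral_const, lintegral_const_mul _ hq3,
    ← lintegral_prod _ (hqm.enorm.pow_const 2).aemeasurable, hball]
  refine le_of_eq ?_
  ring

/-! ### Weak convergence in `L²` and convergence in measure -/

/-- Indicators of balls inside `Ω` lie in `L²(D)`, so weak convergence gives convergence of the ball
averages; the oscillation hypothesis does the rest. -/
theorem tendstoInMeasure_of_weak_of_oscillation {d : ℕ} {D Ω : Set (Eucl d)} (hΩD : Ω ⊆ D)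
    (hΩo : IsOpen Ω) (hΩf : volume Ω < ⊤) {u : ℕ → L2 D} {w : L2 D}
    (hu : ∀ f, Tendsto (fun k => inner ℝ (u k) f) atTop (𝓝 (inner ℝ w f)))
    (hosc : ∀ η : ℝ≥0∞, η ≠ 0 → ∀ᶠ h in 𝓝[>] (0 : ℝ), ∀ k,
      ∫⁻ x in (Metric.thickening h Ωᶜ)ᶜ, ∫⁻ y in Metric.ball x h,
        ‖(u k x - w x) - (u k y - w y)‖ₑ ≤ η * volume (Metric.ball (0 : Eucl d) h)) :
    TendstoInMeasure (volume.restrict Ω) (fun k => u k) atTop w := by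
  have hm : ∀ f : L2 D, Measurable f := fun f => (Lp.stronglyMeasurable f).measurable
  have hi : ∀ f : L2 D, IntegrableOn f Ω := fun f => by
    have : IsFiniteMeasure (volume.restrict Ω) := ⟨by simpa using hΩf⟩
    exact ((Lp.memLp f).mono_measure (Measure.restrict_mono hΩD le_rfl)).integrable
      one_le_two
  have hball : ∀ x h, Metric.ball x h ⊆ Ω → ∃ g : L2 D, ∀ f : L2 D,
      inner ℝ f g = ∫ y in Metric.ball x h, f y := by
    intro x h hx
    refine ⟨indicatorConstLp 2 (s := Metric.ball x h) Metric.isOpen_ball.measurableSet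
      (((Measure.restrict_apply_le _ _).trans_lt measure_ball_lt_top).ne) (1 : ℝ), fun f => ?_⟩
    rw [real_inner_comm, L2.inner_indicatorConstLp_one,
      Measure.restrict_restrict Metric.isOpen_ball.measurableSet,
      Set.inter_eq_left.2 (hx.trans hΩD)]
  have key : TendstoInMeasure (volume.restrict Ω) (fun k x => u k x - w x) atTop 0 := by
    refine tendstoInMeasure_zero_of_oscillation hΩo hΩf (fun k => (hm _).sub (hm _))
      (fun k => (hi _).sub (hi _)) (fun x h hx => ?_) hosc
    obtain ⟨g, hg⟩ := hball x h hx
    have h1 := (hu g).sub_const (inner ℝ w g)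
    rw [sub_self] at h1
    refine h1.congr fun k => ?_
    rw [hg, hg, integral_sub ((hi _).mono_set hx) ((hi _).mono_set hx)]
  rw [tendstoInMeasure_iff_enorm] at key ⊢
  simpa using key

/-- The adjoint moves the test vector back to `W`. -/
theorem tendsto_inner_map_of_weak {W H : Type*} [NormedAddCommGroup W] [InnerProductSpace ℝ W]
    [CompleteSpace W] [NormedAddCommGroup H] [InnerProductSpace ℝ H] [CompleteSpace H]
    (T : W →L[ℝ] H) {u : ℕ → W} {w : W}
    (hu : ∀ v, Tendsto (fun k => inner ℝ (u k) v) atTop (𝓝 (inner ℝ w v))) (f : H) :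
    Tendsto (fun k => inner ℝ (T (u k)) f) atTop (𝓝 (inner ℝ (T w) f)) := by
  simpa only [ContinuousLinearMap.adjoint_inner_right] using hu (T.adjoint f)

theorem enorm_Lp_two_sq {X E : Type*} [MeasurableSpace X] {μ : Measure X} [NormedAddCommGroup E]
    (f : Lp E 2 μ) : ‖f‖ₑ ^ 2 = ∫⁻ x, ‖f x‖ₑ ^ 2 ∂μ := by
  have := eLpNorm_nnreal_pow_eq_lintegral (f := f) (μ := μ) (p := 2) two_ne_zero
  rw [Lp.enorm_def]
  simpa using this

/-! ### The spaces `H^s(Ω)`, `H_0^s(Ω)` and `H̃^s(Ω)` -/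

theorem fracConst_pos (d : ℕ) (s : Set.Ioo (0 : ℝ) 1) : 0 < fracConst d s := by
  have h0 := s.2.1
  have h1 := s.2.2
  have hg : 0 < Real.Gamma (1 - (s : ℝ)) := Real.Gamma_pos_of_pos (by linarith)
  have hg' : 0 < Real.Gamma ((s : ℝ) + (d : ℝ) / 2) := Real.Gamma_pos_of_pos (by positivity)
  unfold fracConst
  positivity

namespace Hs

variable {d : ℕ} {Ω : Set (Eucl d)} {s : Set.Ioo (0 : ℝ) 1}

theorem memLp_diffQuotient (w : Hs Ω s) : MemLp (diffQuotient s (toL2 w)) 2 (prodVolume Ω) :=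
  w.2

/-- The difference quotient as an element of `L²(Ω × Ω)`. -/
def quotL2 : Hs Ω s →ₗ[ℝ] Lp ℝ 2 (prodVolume Ω) where
  toFun w := MemLp.toLp (diffQuotient s (toL2 w)) (memLp_diffQuotient w)
  map_add' u w := by
    rw [← MemLp.toLp_add]
    refine MemLp.toLp_congr _ _ ?_
    rw [map_add]
    exact diffQuotient_add (s : ℝ) (toL2 u) (toL2 w)
  map_smul' a w := by
    rw [RingHom.id_apply, ← MemLp.toLp_const_smul]
    refine MemLp.toLp_congr _ _ ?_
    rw [map_smul]
    exact diffQuotient_smul (s : ℝ) a (toL2 w)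

theorem coeFn_quotL2 (w : Hs Ω s) : quotL2 w =ᵐ[prodVolume Ω] diffQuotient s (toL2 w) :=
  MemLp.coeFn_toLp (memLp_diffQuotient w)

theorem norm_sq_eq (w : Hs Ω s) :
    ‖w‖ ^ 2 = ‖toL2 w‖ ^ 2 + fracConst d s / 2 * ‖quotL2 w‖ ^ 2 := by
  rw [← real_inner_self_eq_norm_sq w, ← real_inner_self_eq_norm_sq (toL2 w),
    ← real_inner_self_eq_norm_sq (quotL2 w)]
  refine (innerHs_eq w w).trans ?_
  congr 2
  rw [L2.inner_def]
  refine integral_congr_ae ?_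
  filter_upwards [coeFn_quotL2 w] with z hz
  simp [hz, sq]

theorem norm_toL2_le (w : Hs Ω s) : ‖toL2 w‖ ≤ ‖w‖ := by
  refine le_of_sq_le_sq ?_ (norm_nonneg _)
  rw [norm_sq_eq]
  have := fracConst_pos d s
  exact le_add_of_nonneg_right (by positivity)

theorem norm_quotL2_sq_le (w : Hs Ω s) : ‖quotL2 w‖ ^ 2 ≤ 2 / fracConst d s * ‖w‖ ^ 2 := by
  have := fracConst_pos d s
  rw [norm_sq_eq, mul_add]
  have h : 2 / fracConst d s * (fracConst d s / 2 * ‖quotL2 w‖ ^ 2) = ‖quotL2 w‖ ^ 2 := by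
    field_simp
  rw [h]
  exact le_add_of_nonneg_left (by positivity)

/-- The continuous inclusion `H^s(Ω) → L²(Ω)`. -/
def toL2CLM : Hs Ω s →L[ℝ] L2 Ω :=
  toL2.mkContinuous 1 fun w => by simpa using norm_toL2_le w

/-- The difference quotient as a continuous linear map. -/
def quotL2CLM : Hs Ω s →L[ℝ] Lp ℝ 2 (prodVolume Ω) :=
  quotL2.mkContinuous √(2 / fracConst d s) fun w => by
    have := fracConst_pos d s
    refine le_of_sq_le_sq ?_ (by positivity)
    rw [mul_pow, Real.sq_sqrt (by positivity)]
    exact norm_quotL2_sq_le w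

/-- For a Cauchy sequence both the functions and their quotients converge in `L²`. Along a common
a.e. convergent subsequence the limit of the quotients is the quotient of the limit, and
`norm_sq_eq` combines the two convergences. -/
instance : CompleteSpace (Hs Ω s) := by
  refine Metric.complete_of_cauchySeq_tendsto fun u hu => ?_
  obtain ⟨w, hw⟩ := cauchySeq_tendsto_of_complete
    ((toL2CLM (Ω := Ω) (s := s)).uniformContinuous.comp_cauchySeq hu)
  obtain ⟨g, hg⟩ := cauchySeq_tendsto_of_complete
    ((quotL2CLM (Ω := Ω) (s := s)).uniformContinuous.comp_cauchySeq hu)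
  have hwg : diffQuotient s w =ᵐ[prodVolume Ω] g := by
    obtain ⟨φ, hφ, hφw⟩ := (tendstoInMeasure_of_tendsto_Lp hw).exists_seq_tendsto_ae
    obtain ⟨ψ, hψ, hψg⟩ :=
      (tendstoInMeasure_of_tendsto_Lp (hg.comp hφ.tendsto_atTop)).exists_seq_tendsto_ae
    have h1 : ∀ᵐ z ∂(prodVolume Ω), Tendsto (fun k => toL2 (u (φ k)) z.1) atTop (𝓝 (w z.1)) :=
      Measure.quasiMeasurePreserving_fst.ae hφw
    have h2 : ∀ᵐ z ∂(prodVolume Ω), Tendsto (fun k => toL2 (u (φ k)) z.2) atTop (𝓝 (w z.2)) :=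
      Measure.quasiMeasurePreserving_snd.ae hφw
    have h3 : ∀ᵐ z ∂(prodVolume Ω), ∀ k, quotL2 (u k) z = diffQuotient s (toL2 (u k)) z :=
      ae_all_iff.2 fun k => coeFn_quotL2 _
    filter_upwards [h1, h2, h3, hψg] with z hz1 hz2 hz3 hz4
    refine tendsto_nhds_unique ?_ hz4
    have h4 := (((hz1.sub hz2).div_const (‖z.1 - z.2‖ ^ ((d : ℝ) / 2 + s))).comp
      hψ.tendsto_atTop)
    refine h4.congr fun k => ?_
    exact (hz3 _).symm
  have hwm : MemLp (diffQuotient s w) 2 (prodVolume Ω) := (memLp_congr_ae hwg).2 (Lp.memLp g)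
  let w' : Hs Ω s := ⟨w, hwm⟩
  have hq : quotL2 w' = g := ((MemLp.toLp_eq_toLp_iff hwm (Lp.memLp g)).2 hwg).trans
    (Lp.toLp_coeFn g (Lp.memLp g))
  refine ⟨w', ?_⟩
  rw [tendsto_iff_norm_sub_tendsto_zero]
  have h5 : Tendsto (fun k => ‖u k - w'‖ ^ 2) atTop (𝓝 0) := by
    have e1 := ((tendsto_iff_norm_sub_tendsto_zero.1 hw).pow 2)
    have e2 := (((tendsto_iff_norm_sub_tendsto_zero.1 hg).pow 2).const_mul (fracConst d s / 2))
    have e3 := e1.add e2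
    simp only [ne_eq, OfNat.ofNat_ne_zero, not_false_eq_true, zero_pow, mul_zero, add_zero] at e3
    refine e3.congr fun k => ?_
    rw [norm_sq_eq, map_sub, map_sub, hq]
    rfl
  have h6 := h5.sqrt
  simpa using h6

theorem lintegral_diffQuotient_le {w : Hs Ω s} {M : ℝ} (hw : ‖w‖ ≤ M) :
    ∫⁻ z, ‖diffQuotient s (toL2 w) z‖ₑ ^ 2 ∂(prodVolume Ω) ≤
      ENNReal.ofReal (2 / fracConst d s * M ^ 2) := by
  have := fracConst_pos d s
  have h1 : ∫⁻ z, ‖diffQuotient s (toL2 w) z‖ₑ ^ 2 ∂(prodVolume Ω) = ‖quotL2 w‖ₑ ^ 2 := by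
    rw [enorm_Lp_two_sq]
    refine lintegral_congr_ae ?_
    filter_upwards [coeFn_quotL2 w] with z hz
    rw [hz]
  rw [h1, ← ofReal_norm, ← ENNReal.ofReal_pow (norm_nonneg _)]
  refine ENNReal.ofReal_le_ofReal ((norm_quotL2_sq_le w).trans ?_)
  gcongr

/-- Bounded sequences of `H^s(D)` that converge weakly in `L²(D)` converge in measure on open
subsets of finite measure. -/
theorem tendstoInMeasure {D : Set (Eucl d)} (hΩD : Ω ⊆ D) (hΩo : IsOpen Ω)
    (hΩf : volume Ω < ⊤) {u : ℕ → Hs D s} {w : Hs D s} {M : ℝ} (hM : ∀ k, ‖u k‖ ≤ M)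
    (hu : ∀ f, Tendsto (fun k => inner ℝ (toL2 (u k)) f) atTop (𝓝 (inner ℝ (toL2 w) f))) :
    TendstoInMeasure (volume.restrict Ω) (fun k => toL2 (u k)) atTop (toL2 w) := by
  refine tendstoInMeasure_of_weak_of_oscillation hΩD hΩo hΩf hu fun η hη => ?_
  -- This is the factor of `h ^ s` in the oscillation bound for `u k - w`, whose norm is at most `M
  -- + ‖w‖`; it depends on neither `k` nor `h`.
  set C : ℝ≥0∞ := volume Ω + (volume (Metric.ball (0 : Eucl d) 1))⁻¹ *
    ENNReal.ofReal (2 / fracConst d s * (M + ‖w‖) ^ 2) with hC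
  have hCt : C ≠ ⊤ := ENNReal.add_ne_top.2 ⟨hΩf.ne, ENNReal.mul_ne_top
    (ENNReal.inv_ne_top.2 (Metric.measure_ball_pos _ _ one_pos).ne') ENNReal.ofReal_ne_top⟩
  have hlim : Tendsto (fun h : ℝ => ENNReal.ofReal (h ^ (s : ℝ)) * C) (𝓝[>] 0) (𝓝 0) := by
    have h1 : Tendsto (fun h : ℝ => h ^ (s : ℝ)) (𝓝[>] 0) (𝓝 0) := by
      have := (Real.continuousAt_rpow_const 0 (s : ℝ) (Or.inr s.2.1.le)).tendsto
      rw [Real.zero_rpow s.2.1.ne'] at this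
      exact this.mono_left nhdsWithin_le_nhds
    have h2 := ENNReal.Tendsto.mul_const (b := C) (ENNReal.tendsto_ofReal h1) (Or.inr hCt)
    simpa using h2
  filter_upwards [ENNReal.tendsto_nhds_zero.1 hlim η (pos_iff_ne_zero.2 hη), self_mem_nhdsWithin]
    with h hh hh0 k
  have hm : ∀ f : L2 D, Measurable f := fun f => (Lp.stronglyMeasurable f).measurable
  refine (lintegral_oscillation_le_of_diffQuotient (w := fun x => toL2 (u k) x - toL2 w x)
    ((hm _).sub (hm _)) s.2.1 hh0).trans ?_
  gcongr
  refine le_trans ?_ hh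
  rw [hC]
  gcongr
  have h3 : ‖u k - w‖ ≤ M + ‖w‖ := (norm_sub_le _ _).trans (by gcongr; exact hM k)
  refine le_trans ?_ (lintegral_diffQuotient_le h3)
  have h4 : (fun x => toL2 (u k) x - toL2 w x) =ᵐ[volume.restrict D] toL2 (u k - w) := by
    rw [map_sub]
    exact (Lp.coeFn_sub _ _).symm
  calc _ ≤ ∫⁻ z, ‖diffQuotient s (fun x => toL2 (u k) x - toL2 w x) z‖ₑ ^ 2 ∂(prodVolume D) := by
        refine lintegral_mono' ?_ le_rfl
        rw [prodVolume, prodVolume, Measure.prod_restrict, Measure.prod_restrict]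
        exact Measure.restrict_mono (Set.prod_mono hΩD hΩD) le_rfl
    _ = _ := by
        refine lintegral_congr_ae ?_
        filter_upwards [diffQuotient_ae_congr s h4] with z hz
        rw [hz]

/-- The minimization problem has a solution in every closed subspace of `H^s(D)`, `D ⊇ Ω`. -/
theorem hasSolution {D : Set (Eucl d)} (hΩD : Ω ⊆ D) (hΩo : IsOpen Ω) (hΩf : volume Ω < ⊤)
    {V : Submodule ℝ (Hs D s)} (hV : IsClosed (V : Set (Hs D s))) {F : V → ℝ}
    (hF : IsAdmissible F) {α β : ℝ} (hα : 0 < α) (hβ : 0 < β) :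
    HasSolution Ω (fun w : V => toL2 w.1) F α β := by
  have : CompleteSpace V := hV.completeSpace_coe
  refine hasSolution_of_tendstoInMeasure hΩf (fun w => (Lp.stronglyMeasurable _).measurable)
    (fun u w M hM hu => ?_) hF hα hβ
  exact tendstoInMeasure hΩD hΩo hΩf (u := fun k => (u k : Hs D s)) hM
    (tendsto_inner_map_of_weak (toL2CLM ∘L V.subtypeL) hu)

end Hs

/-- Limits in `H^s` are `L²` limits, hence a.e. limits along a subsequence, and vanishing off `Ω`
passes to these. -/
theorem isClosed_HTilde {d : ℕ} (Ω : Set (Eucl d)) (s : Set.Ioo (0 : ℝ) 1) :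
    IsClosed (HTilde Ω s : Set (Hs (Set.univ : Set (Eucl d)) s)) := by
  refine isClosed_of_closure_subset fun w hw => ?_
  obtain ⟨u, huV, hu⟩ := mem_closure_iff_seq_limit.1 hw
  have h1 : Tendsto (fun k => Hs.toL2 (u k)) atTop (𝓝 (Hs.toL2 w)) :=
    (Hs.toL2CLM.continuous.tendsto w).comp hu
  obtain ⟨φ, -, hφ⟩ := (tendstoInMeasure_of_tendsto_Lp h1).exists_seq_tendsto_ae
  replace hφ := ae_mono (Measure.restrict_univ (μ := (volume : Measure (Eucl d)))).ge hφ
  change ∀ᵐ x ∂(volume : Measure (Eucl d)), x ∉ Ω → Hs.toL2 w x = 0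
  filter_upwards [hφ, ae_all_iff.2 fun k => (huV (φ k) : ∀ᵐ x ∂(volume : Measure (Eucl d)),
    x ∉ Ω → Hs.toL2 (u (φ k)) x = 0)] with x hx hx0 hxΩ
  exact tendsto_nhds_unique hx (tendsto_const_nhds.congr fun k => (hx0 k hxΩ).symm)

/-! ### Test functions and their gradients -/

namespace IsTestFunction

variable {d : ℕ} {Ω : Set (Eucl d)} {φ ψ : Eucl d → ℝ}

theorem zero : IsTestFunction Ω (0 : Eucl d → ℝ) :=
  ⟨contDiff_const, HasCompactSupport.zero, by simp [tsupport]⟩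

theorem add (hφ : IsTestFunction Ω φ) (hψ : IsTestFunction Ω ψ) : IsTestFunction Ω (φ + ψ) where
  contDiff := hφ.contDiff.add hψ.contDiff
  hasCompactSupport := hφ.hasCompactSupport.add hψ.hasCompactSupport
  tsupport_subset := (tsupport_add φ ψ).trans
    (Set.union_subset hφ.tsupport_subset hψ.tsupport_subset)

theorem const_smul (hφ : IsTestFunction Ω φ) (a : ℝ) : IsTestFunction Ω (a • φ) where
  contDiff := hφ.contDiff.const_smul a
  hasCompactSupport := hφ.hasCompactSupport.smul_left (f := fun _ => a)
  tsupport_subset := (tsupport_smul_subset_right (fun _ => a) φ).trans hφ.tsupport_subset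

theorem differentiable (hφ : IsTestFunction Ω φ) : Differentiable ℝ φ :=
  hφ.contDiff.differentiable (by simp)

theorem continuous_gradient (hφ : IsTestFunction Ω φ) : Continuous (gradient φ) :=
  (InnerProductSpace.toDual ℝ (Eucl d)).symm.continuous.comp
    (hφ.contDiff.continuous_fderiv (by simp))

theorem hasCompactSupport_gradient (hφ : IsTestFunction Ω φ) : HasCompactSupport (gradient φ) :=
  (hφ.hasCompactSupport.fderiv ℝ).comp_left (map_zero (InnerProductSpace.toDual ℝ (Eucl d)).symm)

theorem support_gradient (hφ : IsTestFunction Ω φ) : Function.support (gradient φ) ⊆ Ω := by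
  intro x hx
  refine hφ.tsupport_subset (support_fderiv_subset ℝ fun h => hx ?_)
  simp [gradient, h]

theorem gradient_add (hφ : IsTestFunction Ω φ) (hψ : IsTestFunction Ω ψ) :
    gradient (φ + ψ) = gradient φ + gradient ψ := by
  ext1 x
  simp only [gradient, Pi.add_apply]
  rw [fderiv_add (hφ.differentiable x) (hψ.differentiable x), map_add]

theorem gradient_const_smul (hφ : IsTestFunction Ω φ) (a : ℝ) :
    gradient (a • φ) = a • gradient φ := by
  ext1 x
  simp only [gradient, Pi.smul_apply]
  rw [fderiv_const_smul (hφ.differentiable x), map_smulₛₗ]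
  simp

theorem memLp (hφ : IsTestFunction Ω φ) : MemLp φ 2 (volume.restrict Ω) :=
  (hφ.contDiff.continuous.memLp_of_hasCompactSupport hφ.hasCompactSupport).restrict Ω

theorem memLp_gradient (hφ : IsTestFunction Ω φ) : MemLp (gradient φ) 2 (volume.restrict Ω) :=
  (hφ.continuous_gradient.memLp_of_hasCompactSupport hφ.hasCompactSupport_gradient).restrict Ω

/-- The `L²`-modulus of continuity of a test function is controlled by its gradient. -/
theorem lintegral_translation_sub_le (hφ : IsTestFunction Ω φ) (z : Eucl d) :
    ∫⁻ x, ‖φ (x + z) - φ x‖ₑ ^ 2 ≤ ‖z‖ₑ ^ 2 * ∫⁻ x in Ω, ‖gradient φ x‖ₑ ^ 2 := by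
  -- The segment from `x` to `x + z` is parametrized over a probability space, so the `L¹` norm in
  -- `t` is at most the `L²` norm with constant one.
  set μ : Measure ℝ := volume.restrict (Set.Ioc (0 : ℝ) 1) with hμ
  have hprob : IsProbabilityMeasure μ := ⟨by simp [hμ]⟩
  have hgc : ∀ x : Eucl d, Continuous fun t : ℝ => gradient φ (x + t • z) := fun x =>
    hφ.continuous_gradient.comp (by fun_prop)
  have hpt : ∀ x, ‖φ (x + z) - φ x‖ₑ ^ 2 ≤
      ‖z‖ₑ ^ 2 * ∫⁻ t, ‖gradient φ (x + t • z)‖ₑ ^ 2 ∂μ := by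
    intro x
    have hder : ∀ t ∈ Set.uIcc (0 : ℝ) 1, HasDerivAt (fun t : ℝ => φ (x + t • z))
        (inner ℝ (gradient φ (x + t • z)) z) t := by
      intro t _
      have h1 := (hφ.differentiable (x + t • z)).hasFDerivAt
      have h2 : HasDerivAt (fun t : ℝ => x + t • z) z t := by
        simpa using ((hasDerivAt_id t).smul_const z).const_add x
      have h3 := h1.comp_hasDerivAt t h2
      rwa [← inner_gradient_left] at h3
    have hci : Continuous fun t : ℝ => (inner ℝ (gradient φ (x + t • z)) z : ℝ) :=
      (hgc x).inner continuous_const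
    have hint := intervalIntegral.integral_eq_sub_of_hasDerivAt hder (hci.intervalIntegrable 0 1)
    simp only [one_smul, zero_smul, add_zero] at hint
    rw [intervalIntegral.integral_of_le zero_le_one] at hint
    have h4 : ‖φ (x + z) - φ x‖ₑ ≤ ‖z‖ₑ * ∫⁻ t, ‖gradient φ (x + t • z)‖ₑ ∂μ := by
      rw [← hint, ← lintegral_const_mul _ (hgc x).enorm.measurable]
      refine (enorm_integral_le_lintegral_enorm _).trans (lintegral_mono fun t => ?_)
      rw [mul_comm]
      simp only [← ofReal_norm]
      rw [← ENNReal.ofReal_mul (norm_nonneg _)]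
      exact ENNReal.ofReal_le_ofReal (norm_inner_le_norm _ _)
    have h5 : (∫⁻ t, ‖gradient φ (x + t • z)‖ₑ ∂μ) ^ 2 ≤
        ∫⁻ t, ‖gradient φ (x + t • z)‖ₑ ^ 2 ∂μ := by
      have h6 := eLpNorm_le_eLpNorm_of_exponent_le (μ := μ) one_le_two
        (hgc x).aestronglyMeasurable
      have h7 := eLpNorm_nnreal_pow_eq_lintegral (f := fun t : ℝ => gradient φ (x + t • z))
        (μ := μ) (p := 2) two_ne_zero
      rw [eLpNorm_one_eq_lintegral_enorm] at h6
      calc _ ≤ _ := pow_le_pow_left' h6 2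
        _ = _ := by simpa using h7
    calc _ ≤ _ := pow_le_pow_left' h4 2
      _ ≤ _ := by rw [mul_pow]; gcongr
  have hjoint : Continuous fun p : Eucl d × ℝ => gradient φ (p.1 + p.2 • z) :=
    hφ.continuous_gradient.comp (by fun_prop)
  have hm : Measurable fun p : Eucl d × ℝ => ‖gradient φ (p.1 + p.2 • z)‖ₑ ^ 2 :=
    hjoint.enorm.measurable.pow_const 2
  refine (lintegral_mono hpt).trans ?_
  -- After Tonelli, the space integral for fixed `t` does not see the shift by `t • z`, and the
  -- gradient vanishes off `Ω`.
  rw [lintegral_const_mul _ hm.lintegral_prod_right', lintegral_lintegral_swap hm.aemeasurable]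
  gcongr
  calc _ = ∫⁻ _t : ℝ, (∫⁻ x, ‖gradient φ x‖ₑ ^ 2) ∂μ := by
        refine lintegral_congr fun t => ?_
        exact lintegral_add_right_eq_self (fun x => ‖gradient φ x‖ₑ ^ 2) (t • z)
    _ = ∫⁻ x, ‖gradient φ x‖ₑ ^ 2 := by simp
    _ = ∫⁻ x in Ω, ‖gradient φ x‖ₑ ^ 2 := by
        refine (setLIntegral_eq_of_support_subset fun x hx => hφ.support_gradient ?_).symm
        intro h
        exact hx (by simp [h])
    _ ≤ _ := le_rfl

end IsTestFunction

/-! ### Extension by zero and translations -/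

section Translation

variable {d : ℕ} {Ω : Set (Eucl d)}

theorem memLp_indicator (hΩ : MeasurableSet Ω) (w : L2 Ω) :
    MemLp (Ω.indicator w) 2 (volume : Measure (Eucl d)) :=
  (memLp_indicator_iff_restrict hΩ).2 (Lp.memLp w)

/-- Extension by zero, as an isometry of `L²(Ω)` into `L²(ℝ^d)`. -/
def extendZero (hΩ : MeasurableSet Ω) : L2 Ω →ₗᵢ[ℝ] Lp ℝ 2 (volume : Measure (Eucl d)) where
  toFun w := MemLp.toLp (Ω.indicator w) (memLp_indicator hΩ w)
  map_add' u w := by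
    rw [← MemLp.toLp_add]
    refine MemLp.toLp_congr _ _ ?_
    rw [← Set.indicator_add', ← ae_eq_restrict_iff_indicator_ae_eq hΩ]
    exact Lp.coeFn_add u w
  map_smul' a w := by
    rw [RingHom.id_apply, ← MemLp.toLp_const_smul]
    refine MemLp.toLp_congr _ _ ?_
    have h : a • Ω.indicator (w : Eucl d → ℝ) = Ω.indicator (a • (w : Eucl d → ℝ)) :=
      (Set.indicator_const_smul Ω a (w : Eucl d → ℝ)).symm
    rw [h, ← ae_eq_restrict_iff_indicator_ae_eq hΩ]
    exact Lp.coeFn_smul a w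
  norm_map' w := by
    change ‖MemLp.toLp (Ω.indicator w) (memLp_indicator hΩ w)‖ = ‖w‖
    rw [Lp.norm_toLp, eLpNorm_indicator_eq_eLpNorm_restrict hΩ, Lp.norm_def]

theorem coeFn_extendZero (hΩ : MeasurableSet Ω) {w : L2 Ω} {f : Eucl d → ℝ}
    (hf : w =ᵐ[volume.restrict Ω] f) : extendZero hΩ w =ᵐ[volume] Ω.indicator f :=
  (MemLp.coeFn_toLp (memLp_indicator hΩ w)).trans
    ((ae_eq_restrict_iff_indicator_ae_eq hΩ).1 hf)

/-- The operator `w ↦ w(· + z) - w` on functions extended by zero. -/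
def translationSub (hΩ : MeasurableSet Ω) (z : Eucl d) :
    L2 Ω →L[ℝ] Lp ℝ 2 (volume : Measure (Eucl d)) :=
  (Lp.compMeasurePreservingₗᵢ ℝ (fun x => x + z)
    (measurePreserving_add_right volume z)).toContinuousLinearMap ∘L
      (extendZero hΩ).toContinuousLinearMap - (extendZero hΩ).toContinuousLinearMap

/-- An arbitrary representative `f` is allowed so that test functions and pointwise differences can
be inserted directly. -/
theorem coeFn_translationSub (hΩ : MeasurableSet Ω) (z : Eucl d) {w : L2 Ω} {f : Eucl d → ℝ}
    (hf : w =ᵐ[volume.restrict Ω] f) :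
    translationSub hΩ z w =ᵐ[volume] fun x => Ω.indicator f (x + z) - Ω.indicator f x := by
  have h1 := coeFn_extendZero hΩ hf
  have h2 := Lp.coeFn_compMeasurePreserving (extendZero hΩ w)
    (measurePreserving_add_right (volume : Measure (Eucl d)) z)
  have h3 := (measurePreserving_add_right (volume : Measure (Eucl d)) z).quasiMeasurePreserving.ae
    h1
  have h4 : translationSub hΩ z w = Lp.compMeasurePreserving (fun x => x + z)
      (measurePreserving_add_right (volume : Measure (Eucl d)) z) (extendZero hΩ w) -
        extendZero hΩ w := rfl
  rw [h4]
  filter_upwards [Lp.coeFn_sub (Lp.compMeasurePreserving (fun x => x + z)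
      (measurePreserving_add_right (volume : Measure (Eucl d)) z) (extendZero hΩ w))
        (extendZero hΩ w), h1, h2, h3] with x hx1 hx2 hx3 hx4
  rw [hx1, Pi.sub_apply, hx2, hx3, Function.comp_apply, hx4]

theorem norm_translationSub_le (hΩ : MeasurableSet Ω) (z : Eucl d) (w : L2 Ω) :
    ‖translationSub hΩ z w‖ ≤ 2 * ‖w‖ := by
  refine (norm_sub_le _ _).trans (le_of_eq ?_)
  change ‖Lp.compMeasurePreservingₗᵢ ℝ _ _ (extendZero hΩ w)‖ + ‖extendZero hΩ w‖ = _
  rw [LinearIsometry.norm_map, LinearIsometry.norm_map, two_mul]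

/-- If `Ω + z` is disjoint from `Ω`, then `‖w‖ ≤ ‖w(· + z) - w‖`. -/
theorem norm_le_norm_translationSub (hΩ : MeasurableSet Ω) {z : Eucl d}
    (hz : ∀ x ∈ Ω, x + z ∉ Ω) (w : L2 Ω) : ‖w‖ ≤ ‖translationSub hΩ z w‖ := by
  have h : ‖w‖ₑ ^ 2 ≤ ‖translationSub hΩ z w‖ₑ ^ 2 := by
    rw [enorm_Lp_two_sq, enorm_Lp_two_sq]
    refine le_trans (le_of_eq ?_) (setLIntegral_le_lintegral Ω _)
    refine lintegral_congr_ae ?_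
    filter_upwards [ae_restrict_of_ae (coeFn_translationSub hΩ z (ae_eq_refl w)),
      ae_restrict_mem hΩ] with x hx hxΩ
    rw [hx, Set.indicator_of_notMem (hz x hxΩ), Set.indicator_of_mem hxΩ, zero_sub, enorm_neg]
  rw [← ofReal_norm, ← ofReal_norm, ← ENNReal.ofReal_pow (norm_nonneg _),
    ← ENNReal.ofReal_pow (norm_nonneg _), ENNReal.ofReal_le_ofReal_iff (by positivity)] at h
  exact le_of_sq_le_sq h (norm_nonneg _)

/-- This is the Cauchy–Schwarz inequality on `Ω`, passing from `L²` translation bounds to the `L¹`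
bounds used for the oscillation. -/
theorem lintegral_translation_le (hΩ : MeasurableSet Ω) (z : Eucl d) {w : L2 Ω} {f : Eucl d → ℝ}
    (hf : w =ᵐ[volume.restrict Ω] f) :
    ∫⁻ x in Ω, ‖Ω.indicator f (x + z) - Ω.indicator f x‖ₑ ≤
      ‖translationSub hΩ z w‖ₑ * volume Ω ^ (1 / 2 : ℝ) := by
  have h1 : ∫⁻ x in Ω, ‖Ω.indicator f (x + z) - Ω.indicator f x‖ₑ =
      eLpNorm (translationSub hΩ z w) 1 (volume.restrict Ω) := by
    rw [eLpNorm_one_eq_lintegral_enorm]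
    refine lintegral_congr_ae ?_
    filter_upwards [ae_restrict_of_ae (coeFn_translationSub hΩ z hf)] with x hx
    rw [hx]
  rw [h1]
  have h0 : AEStronglyMeasurable (translationSub hΩ z w) (volume.restrict Ω) :=
    (Lp.aestronglyMeasurable _).restrict
  refine (eLpNorm_le_eLpNorm_mul_rpow_measure_univ one_le_two h0).trans ?_
  rw [Measure.restrict_apply_univ, Lp.enorm_def]
  have h2 : (1 / (1 : ℝ≥0∞).toReal - 1 / (2 : ℝ≥0∞).toReal) = 1 / 2 := by norm_num
  rw [h2]
  exact mul_le_mul' (eLpNorm_mono_measure _ Measure.restrict_le_self) le_rfl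

end Translation

/-! ### `H_0^1(Ω)` as a closed graph, and Dirichlet eigenfunctions -/

/-- The Hilbert space `L²(Ω; ℝ^d)`. -/
abbrev L2Vec {d : ℕ} (Ω : Set (Eucl d)) : Type := Lp (Eucl d) 2 (volume.restrict Ω)

/-- The graph of the gradient on test functions. -/
def testGraph {d : ℕ} (Ω : Set (Eucl d)) : Submodule ℝ (L2 Ω × L2Vec Ω) where
  carrier := {p | ∃ φ, IsTestFunction Ω φ ∧ p.1 =ᵐ[volume.restrict Ω] φ ∧
    p.2 =ᵐ[volume.restrict Ω] gradient φ}
  zero_mem' := ⟨0, IsTestFunction.zero, Lp.coeFn_zero _ _ _, by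
    have : gradient (0 : Eucl d → ℝ) = 0 := by
      ext1 x
      simp [gradient]
    rw [this]
    exact Lp.coeFn_zero _ _ _⟩
  add_mem' := by
    rintro p q ⟨φ, hφ, h1, h2⟩ ⟨ψ, hψ, h3, h4⟩
    refine ⟨φ + ψ, hφ.add hψ, (Lp.coeFn_add _ _).trans (h1.add h3), ?_⟩
    rw [hφ.gradient_add hψ]
    exact (Lp.coeFn_add _ _).trans (h2.add h4)
  smul_mem' := by
    rintro a p ⟨φ, hφ, h1, h2⟩
    refine ⟨a • φ, hφ.const_smul a, (Lp.coeFn_smul _ _).trans (h1.const_smul a), ?_⟩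
    rw [hφ.gradient_const_smul]
    exact (Lp.coeFn_smul _ _).trans (h2.const_smul a)

/-- The graph of the weak gradient on `H_0^1(Ω)`. -/
def gradGraph {d : ℕ} (Ω : Set (Eucl d)) : Submodule ℝ (L2 Ω × L2Vec Ω) :=
  (testGraph Ω).topologicalClosure

section Eigen

variable {d : ℕ} {Ω : Set (Eucl d)}

/-- A closed condition on pairs `(w, ∇w)` need only be checked for test functions. -/
theorem gradGraph_induction {P : L2 Ω × L2Vec Ω → Prop} (hP : IsClosed {p | P p})
    (h : ∀ p ∈ testGraph Ω, P p) : ∀ p ∈ gradGraph Ω, P p := by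
  intro p hp
  have : (testGraph Ω : Set (L2 Ω × L2Vec Ω)) ⊆ {p | P p} := h
  exact closure_minimal this hP hp

theorem HasH01Gradient.mem_gradGraph {w : L2 Ω} {G : Eucl d → Eucl d}
    (h : HasH01Gradient Ω w G) : (w, h.memLp_grad.toLp G) ∈ gradGraph Ω := by
  obtain ⟨φ, hφ, h1, h2⟩ := h.approx
  refine mem_closure_of_tendsto (b := atTop)
    (f := fun n => ((hφ n).memLp.toLp (φ n), (hφ n).memLp_gradient.toLp (gradient (φ n)))) ?_ ?_
  · refine Tendsto.prodMk_nhds ?_ ?_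
    · have := (Lp.tendsto_Lp_iff_tendsto_eLpNorm'' φ (fun n => (hφ n).memLp) w h.memLp).2 h1
      rwa [Lp.toLp_coeFn] at this
    · exact (Lp.tendsto_Lp_iff_tendsto_eLpNorm'' _ (fun n => (hφ n).memLp_gradient) G
        h.memLp_grad).2 h2
  · exact Eventually.of_forall fun n => ⟨φ n, hφ n, MemLp.coeFn_toLp (hφ n).memLp,
      MemLp.coeFn_toLp (hφ n).memLp_gradient⟩

/-- Extension by zero does not change a test function, so
`IsTestFunction.lintegral_translation_sub_le` applies; the inequality then survives the closure. -/
theorem norm_translationSub_le_of_mem_gradGraph (hΩ : MeasurableSet Ω) (z : Eucl d) :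
    ∀ p ∈ gradGraph Ω, ‖translationSub hΩ z p.1‖ ≤ ‖z‖ * ‖p.2‖ := by
  refine gradGraph_induction (isClosed_le (by fun_prop) (by fun_prop)) ?_
  rintro ⟨u, g⟩ ⟨φ, hφ, h1, h2⟩
  have hind : Ω.indicator φ = φ :=
    Set.indicator_eq_self.2 ((subset_tsupport φ).trans hφ.tsupport_subset)
  have h : ‖translationSub hΩ z u‖ₑ ^ 2 ≤ ‖z‖ₑ ^ 2 * ‖g‖ₑ ^ 2 := by
    rw [enorm_Lp_two_sq, enorm_Lp_two_sq]
    refine le_trans (le_of_eq ?_) ((hφ.lintegral_translation_sub_le z).trans (le_of_eq ?_))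
    · refine lintegral_congr_ae ?_
      filter_upwards [coeFn_translationSub hΩ z h1] with x hx
      rw [hx, hind]
    · congr 1
      refine lintegral_congr_ae ?_
      filter_upwards [h2] with x hx
      rw [hx]
  rw [← mul_pow, ← ofReal_norm, ← ofReal_norm, ← ofReal_norm, ← ENNReal.ofReal_mul (norm_nonneg _),
    ← ENNReal.ofReal_pow (norm_nonneg _), ← ENNReal.ofReal_pow (by positivity),
    ENNReal.ofReal_le_ofReal_iff (by positivity)] at h
  exact le_of_sq_le_sq h (by positivity)

/-- The pairs `(w, ∇w)` where `w` is a Dirichlet eigenfunction for the eigenvalue `lam`. -/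
def eigenGraph (Ω : Set (Eucl d)) (lam : ℝ) : Submodule ℝ (L2 Ω × L2Vec Ω) where
  carrier := {p | p ∈ gradGraph Ω ∧
    ∀ q ∈ gradGraph Ω, inner ℝ p.2 q.2 = lam * inner ℝ p.1 q.1}
  zero_mem' := ⟨zero_mem _, by simp⟩
  add_mem' := by
    rintro p q ⟨hp, hp'⟩ ⟨hq, hq'⟩
    refine ⟨add_mem hp hq, fun r hr => ?_⟩
    rw [Prod.snd_add, Prod.fst_add, inner_add_left, inner_add_left, hp' r hr, hq' r hr, mul_add]
  smul_mem' := by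
    rintro a p ⟨hp, hp'⟩
    refine ⟨Submodule.smul_mem _ a hp, fun r hr => ?_⟩
    rw [Prod.smul_snd, Prod.smul_fst, real_inner_smul_left, real_inner_smul_left, hp' r hr]
    ring

theorem isClosed_eigenGraph (lam : ℝ) :
    IsClosed (eigenGraph Ω lam : Set (L2 Ω × L2Vec Ω)) := by
  have : (eigenGraph Ω lam : Set (L2 Ω × L2Vec Ω)) = (gradGraph Ω : Set (L2 Ω × L2Vec Ω)) ∩
      ⋂ q ∈ gradGraph Ω, {p | inner ℝ p.2 q.2 = lam * inner ℝ p.1 q.1} := by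
    ext p
    simp [eigenGraph]
  rw [this]
  refine (Submodule.isClosed_topologicalClosure _).inter (isClosed_biInter fun q _ => ?_)
  exact isClosed_eq (by fun_prop) (by fun_prop)

theorem norm_sq_of_mem_eigenGraph {lam : ℝ} {p : L2 Ω × L2Vec Ω} (hp : p ∈ eigenGraph Ω lam) :
    ‖p.2‖ ^ 2 = lam * ‖p.1‖ ^ 2 := by
  rw [← real_inner_self_eq_norm_sq, ← real_inner_self_eq_norm_sq]
  exact hp.2 p hp.1

/-- Both sides of the weak equation are continuous in the test pair, so it extends from test
functions to the whole of `gradGraph`. -/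
theorem IsDirichletSolution.exists_mem_eigenGraph {lam : ℝ} {w : L2 Ω}
    (h : IsDirichletSolution Ω lam w) : ∃ G, (w, G) ∈ eigenGraph Ω lam := by
  obtain ⟨G, hG, hweak⟩ := h
  refine ⟨hG.memLp_grad.toLp G, hG.mem_gradGraph, ?_⟩
  refine gradGraph_induction (isClosed_eq (by fun_prop) (by fun_prop)) ?_
  rintro ⟨u, g⟩ ⟨φ, hφ, h1, h2⟩
  rw [L2.inner_def, L2.inner_def]
  have e1 : ∫ x in Ω, inner ℝ (hG.memLp_grad.toLp G x) (g x) =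
      ∫ x in Ω, inner ℝ (G x) (gradient φ x) := by
    refine integral_congr_ae ?_
    filter_upwards [hG.memLp_grad.coeFn_toLp, h2] with x hx1 hx2
    rw [hx1, hx2]
  have e2 : ∫ x in Ω, inner ℝ (w x) (u x) = ∫ x in Ω, w x * φ x := by
    refine integral_congr_ae ?_
    filter_upwards [h1] with x hx
    rw [hx]
    simp [mul_comm]
  exact e1.trans ((hweak φ hφ).trans (by rw [e2]))

/-- `dirichletEigenspace` is a closure, so a gradient is not given for its elements. On `eigenGraph`
the norm of the gradient is `√lam` times that of the function, so the first projection is bounded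
below, its range is closed, and the range contains the eigenspace. -/
theorem exists_mem_eigenGraph {lam : ℝ} (hlam : 0 < lam) {w : L2 Ω}
    (hw : w ∈ dirichletEigenspace Ω lam) : ∃ G, (w, G) ∈ eigenGraph Ω lam := by
  have : CompleteSpace (eigenGraph Ω lam) := (isClosed_eigenGraph lam).completeSpace_coe
  let T : eigenGraph Ω lam →L[ℝ] L2 Ω :=
    ContinuousLinearMap.fst ℝ (L2 Ω) (L2Vec Ω) ∘L (eigenGraph Ω lam).subtypeL
  have hT : AntilipschitzWith (1 + NNReal.sqrt lam.toNNReal) T := by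
    refine T.antilipschitz_of_bound fun p => ?_
    have h1 := norm_sq_of_mem_eigenGraph p.2
    have h2 : ‖p.1.2‖ = √lam * ‖p.1.1‖ := by
      rw [← Real.sqrt_sq (norm_nonneg p.1.2), h1, Real.sqrt_mul hlam.le,
        Real.sqrt_sq (norm_nonneg _)]
    change max ‖p.1.1‖ ‖p.1.2‖ ≤ (1 + NNReal.sqrt lam.toNNReal : NNReal) * ‖p.1.1‖
    rw [NNReal.coe_add, NNReal.coe_one, Real.coe_sqrt, Real.coe_toNNReal _ hlam.le, h2]
    have := norm_nonneg p.1.1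
    have := Real.sqrt_nonneg lam
    refine max_le ?_ ?_ <;> nlinarith
  have hcl : IsClosed (Set.range T) := hT.isClosed_range T.uniformContinuous
  have hle : dirichletEigenspace Ω lam ≤ LinearMap.range T.toLinearMap := by
    refine Submodule.topologicalClosure_minimal _ (Submodule.span_le.2 fun v hv => ?_) hcl
    obtain ⟨G, hG⟩ := IsDirichletSolution.exists_mem_eigenGraph hv
    exact ⟨⟨(v, G), hG⟩, rfl⟩
  obtain ⟨p, hp⟩ := hle hw
  refine ⟨p.1.2, ?_⟩
  rw [← hp]
  exact p.2

/-- Testing each eigenvalue equation with the other eigenfunction gives `lam * (u, w) = mu * (u,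
w)`. -/
theorem inner_eq_zero_of_mem_dirichletEigenspace {lam mu : ℝ} (hlam : 0 < lam) (hmu : 0 < mu)
    (hne : lam ≠ mu) {u w : L2 Ω} (hu : u ∈ dirichletEigenspace Ω lam)
    (hw : w ∈ dirichletEigenspace Ω mu) : inner ℝ u w = 0 := by
  obtain ⟨G, hG⟩ := exists_mem_eigenGraph hlam hu
  obtain ⟨K, hK⟩ := exists_mem_eigenGraph hmu hw
  have h1 : inner ℝ G K = lam * inner ℝ u w := hG.2 (w, K) hK.1
  have h2 : inner ℝ K G = mu * inner ℝ w u := hK.2 (u, G) hG.1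
  rw [real_inner_comm, real_inner_comm u w, h1] at h2
  have h3 : (lam - mu) * inner ℝ u w = 0 := by rw [sub_mul, h2, sub_self]
  exact (mul_eq_zero.1 h3).resolve_left (sub_ne_zero.2 hne)

theorem orthogonalFamily_dirichletEigenspace (Ω : Set (Eucl d)) :
    OrthogonalFamily ℝ (fun lam : PosReal => dirichletEigenspace Ω lam)
      fun lam => (dirichletEigenspace Ω lam).subtypeₗᵢ :=
  fun lam mu hne u w => inner_eq_zero_of_mem_dirichletEigenspace lam.2 mu.2
    (fun h => hne (Subtype.ext h)) u.2 w.2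

theorem norm_sum_eigen_sq (F : Finset PosReal) {v : PosReal → L2 Ω}
    (hv : ∀ lam : PosReal, v lam ∈ dirichletEigenspace Ω lam) :
    ‖∑ lam ∈ F, v lam‖ ^ 2 = ∑ lam ∈ F, ‖v lam‖ ^ 2 :=
  (orthogonalFamily_dirichletEigenspace Ω).norm_sum (fun lam => ⟨v lam, hv lam⟩) F

/-- Translation estimate for sums of eigenfunctions with eigenvalues at most `Lam`. -/
theorem norm_translationSub_sum_le (hΩ : MeasurableSet Ω) (z : Eucl d) {F : Finset PosReal}
    {Lam : ℝ} (hF : ∀ lam ∈ F, (lam : ℝ) ≤ Lam) {v : PosReal → L2 Ω}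
    (hv : ∀ lam : PosReal, v lam ∈ dirichletEigenspace Ω lam) :
    ‖translationSub hΩ z (∑ lam ∈ F, v lam)‖ ≤ ‖z‖ * (√Lam * ‖∑ lam ∈ F, v lam‖) := by
  choose G hG using fun lam : PosReal => exists_mem_eigenGraph lam.2 (hv lam)
  have hmem : (∑ lam ∈ F, v lam, ∑ lam ∈ F, G lam) ∈ gradGraph Ω := by
    have := Submodule.sum_mem (gradGraph Ω) (t := F) fun lam _ => (hG lam).1
    convert this using 1
    simp [Prod.ext_iff, Prod.fst_sum, Prod.snd_sum]
  refine (norm_translationSub_le_of_mem_gradGraph hΩ z _ hmem).trans ?_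
  refine mul_le_mul_of_nonneg_left ?_ (norm_nonneg _)
  -- Each eigenvalue equation is tested with the whole sum, and orthogonality leaves only the
  -- diagonal terms.
  have h1 : ‖∑ lam ∈ F, G lam‖ ^ 2 = ∑ lam ∈ F, (lam : ℝ) * ‖v lam‖ ^ 2 := by
    rw [← real_inner_self_eq_norm_sq, sum_inner]
    refine Finset.sum_congr rfl fun lam hlam => ?_
    refine ((hG lam).2 _ hmem).trans ?_
    congr 1
    rw [inner_sum, Finset.sum_eq_single lam, real_inner_self_eq_norm_sq]
    · intro mu _ hmu
      exact inner_eq_zero_of_mem_dirichletEigenspace lam.2 mu.2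
        (fun h => hmu (Subtype.ext h.symm)) (hv lam) (hv mu)
    · exact fun h => absurd hlam h
  have h2 : ‖∑ lam ∈ F, G lam‖ ^ 2 ≤ Lam * ‖∑ lam ∈ F, v lam‖ ^ 2 := by
    rw [h1, norm_sum_eigen_sq F hv, Finset.mul_sum]
    exact Finset.sum_le_sum fun lam hlam =>
      mul_le_mul_of_nonneg_right (hF lam hlam) (by positivity)
  have h3 := Real.sqrt_le_sqrt h2
  rwa [Real.sqrt_sq (norm_nonneg _), Real.sqrt_mul' _ (by positivity),
    Real.sqrt_sq (norm_nonneg _)] at h3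

/-- If `Ω` lies in the open ball of radius `R` about the origin, two of its points cannot differ by
a vector of length `2 * R`; `1 ≤ d` provides a coordinate direction. -/
theorem exists_forall_add_notMem (hd : 1 ≤ d) (hb : Bornology.IsBounded Ω) :
    ∃ z : Eucl d, z ≠ 0 ∧ ∀ x ∈ Ω, x + z ∉ Ω := by
  obtain ⟨R, hR0, hR⟩ := hb.subset_ball_lt 0 0
  refine ⟨EuclideanSpace.single ⟨0, hd⟩ (2 * R), ?_, fun x hx hxz => ?_⟩
  · simp [hR0.ne']
  · have h1 := mem_ball_zero_iff.1 (hR hx)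
    have h2 := mem_ball_zero_iff.1 (hR hxz)
    have h3 := norm_sub_le (x + EuclideanSpace.single ⟨0, hd⟩ (2 * R)) x
    rw [add_sub_cancel_left, PiLp.norm_single, Real.norm_of_nonneg (by positivity)] at h3
    linarith

/-- The Dirichlet eigenvalues of a bounded domain are bounded away from zero. -/
theorem exists_le_eigenvalue (hd : 1 ≤ d) (hΩ : MeasurableSet Ω) (hb : Bornology.IsBounded Ω) :
    ∃ c : ℝ, 0 < c ∧ ∀ (lam : PosReal) (w : L2 Ω), w ∈ dirichletEigenspace Ω lam → w ≠ 0 →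
      c ≤ (lam : ℝ) := by
  obtain ⟨z, hz0, hz⟩ := exists_forall_add_notMem hd hb
  have hz1 : 0 < ‖z‖ := norm_pos_iff.2 hz0
  refine ⟨(‖z‖ ^ 2)⁻¹, by positivity, fun lam w hw hw0 => ?_⟩
  obtain ⟨G, hG⟩ := exists_mem_eigenGraph lam.2 hw
  have h0 : ‖translationSub hΩ z w‖ ≤ ‖z‖ * ‖G‖ :=
    norm_translationSub_le_of_mem_gradGraph hΩ z (w, G) hG.1
  -- Poincaré inequality: a shift moving `Ω` off itself makes the translation difference at least as
  -- large as `w`.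
  have h1 : ‖w‖ ≤ ‖z‖ * ‖G‖ := (norm_le_norm_translationSub hΩ hz w).trans h0
  have h2 : ‖G‖ ^ 2 = lam * ‖w‖ ^ 2 :=
    norm_sq_of_mem_eigenGraph (p := (w, G)) hG
  have h3 : 0 < ‖w‖ := norm_pos_iff.2 hw0
  have h4 := pow_le_pow_left₀ (norm_nonneg _) h1 2
  rw [mul_pow, h2] at h4
  rw [inv_le_iff_one_le_mul₀ (by positivity)]
  have h5 : 1 * ‖w‖ ^ 2 ≤ (lam * ‖z‖ ^ 2) * ‖w‖ ^ 2 := by linarith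
  exact le_of_mul_le_mul_right h5 (by positivity)

end Eigen

/-! ### The spectral space -/

section

variable {d : ℕ} {Ω : Set (Eucl d)}

theorem eigenProj_mem (lam : ℝ) (w : L2 Ω) : eigenProj Ω lam w ∈ dirichletEigenspace Ω lam :=
  Submodule.starProjection_apply_mem _ _

theorem eigenProj_eq_self {lam : ℝ} {w : L2 Ω} (hw : w ∈ dirichletEigenspace Ω lam) :
    eigenProj Ω lam w = w :=
  Submodule.starProjection_eq_self_iff.2 hw

theorem eigenProj_eq_zero {lam mu : PosReal} (hne : mu ≠ lam) {w : L2 Ω}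
    (hw : w ∈ dirichletEigenspace Ω mu) : eigenProj Ω lam w = 0 := by
  refine (Submodule.starProjection_apply_eq_zero_iff _).2 fun v hv => ?_
  exact inner_eq_zero_of_mem_dirichletEigenspace lam.2 mu.2
    (fun h => hne (Subtype.ext h.symm)) hv hw

/-- The eigenfunction expansion. -/
theorem hasSum_eigenProj {w : L2 Ω}
    (hw : w ∈ (⨆ lam : PosReal, dirichletEigenspace Ω lam).topologicalClosure) :
    HasSum (fun lam : PosReal => eigenProj Ω lam w) w := by
  have hV := orthogonalFamily_dirichletEigenspace Ω
  -- The closed span is the isometric image of the Hilbert sum of the eigenspaces; applying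
  -- `eigenProj` to the resulting series identifies its terms.
  have hw' : w ∈ hV.linearIsometry.range := by
    rw [hV.range_linearIsometry]
    simpa using hw
  obtain ⟨f, hf⟩ := hw'
  have hf' : hV.linearIsometry f = w := hf
  have h := hV.hasSum_linearIsometry f
  rw [hf'] at h
  refine h.congr_fun fun lam => ?_
  have h1 := h.mapL (eigenProj Ω lam)
  have h2 : HasSum (fun mu : PosReal => eigenProj Ω lam ((f mu : dirichletEigenspace Ω mu) : L2 Ω))
      (eigenProj Ω lam ((f lam : dirichletEigenspace Ω lam) : L2 Ω)) :=
    hasSum_single lam fun mu hmu => eigenProj_eq_zero hmu (f mu).2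
  rw [h1.unique h2]
  exact eigenProj_eq_self (f lam).2

theorem inner_eigenProj_self (lam : ℝ) (w : L2 Ω) :
    inner ℝ w (eigenProj Ω lam w) = ‖eigenProj Ω lam w‖ ^ 2 := by
  rw [real_inner_comm]
  exact Submodule.re_inner_starProjection_eq_normSq (𝕜 := ℝ) (dirichletEigenspace Ω lam) w

/-- Parseval's identity, from pairing the expansion with `w`. -/
theorem hasSum_norm_eigenProj_sq {w : L2 Ω}
    (hw : w ∈ (⨆ lam : PosReal, dirichletEigenspace Ω lam).topologicalClosure) :
    HasSum (fun lam : PosReal => ‖eigenProj Ω lam w‖ ^ 2) (‖w‖ ^ 2) := by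
  have h := (hasSum_eigenProj hw).mapL (innerSL ℝ w)
  simpa only [innerSL_apply_apply, inner_eigenProj_self, real_inner_self_eq_norm_sq] using h

end

namespace SpecHs

variable {d : ℕ} {Ω : Set (Eucl d)} {s : Set.Ioo (0 : ℝ) 1}

theorem toL2_mem (w : SpecHs Ω s) :
    toL2 w ∈ (⨆ lam : PosReal, dirichletEigenspace Ω lam).topologicalClosure :=
  w.2.1

theorem hasSum_norm_sq (w : SpecHs Ω s) :
    HasSum (fun lam : PosReal => (lam : ℝ) ^ (s : ℝ) * ‖eigenProj Ω lam (toL2 w)‖ ^ 2)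
      (‖w‖ ^ 2) := by
  have h : HasSum _ (innerSpec w w) := (summable_inner w w).hasSum
  have h1 : ‖w‖ ^ 2 = innerSpec w w := (real_inner_self_eq_norm_sq w).symm
  rw [h1]
  simpa only [real_inner_self_eq_norm_sq] using h

theorem sum_le_norm_sq (w : SpecHs Ω s) (F : Finset PosReal) :
    ∑ lam ∈ F, (lam : ℝ) ^ (s : ℝ) * ‖eigenProj Ω lam (toL2 w)‖ ^ 2 ≤ ‖w‖ ^ 2 :=
  sum_le_hasSum F (fun lam _ => mul_nonneg (Real.rpow_nonneg lam.2.le _) (by positivity))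
    (hasSum_norm_sq w)

/-- The embedding of the spectral space into `L²(Ω)` is bounded. -/
theorem exists_norm_toL2_le (hd : 1 ≤ d) (hΩ : MeasurableSet Ω) (hb : Bornology.IsBounded Ω) :
    ∃ C : ℝ, 0 ≤ C ∧ ∀ w : SpecHs Ω s, ‖toL2 w‖ ≤ C * ‖w‖ := by
  obtain ⟨c, hc, hlam⟩ := exists_le_eigenvalue hd hΩ hb
  have hcs : 0 < c ^ (s : ℝ) := Real.rpow_pos_of_pos hc _
  refine ⟨√(c ^ (s : ℝ))⁻¹, Real.sqrt_nonneg _, fun w => ?_⟩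
  refine le_of_sq_le_sq ?_ (by positivity)
  rw [mul_pow, Real.sq_sqrt (by positivity), inv_mul_eq_div, le_div_iff₀ hcs]
  -- The comparison is termwise: a nonzero projection forces `c ≤ lam`.
  refine hasSum_le (fun lam => ?_) ((hasSum_norm_eigenProj_sq (toL2_mem w)).mul_right _)
    (hasSum_norm_sq w)
  by_cases h0 : eigenProj Ω lam (toL2 w) = 0
  · simp [h0]
  · rw [mul_comm]
    refine mul_le_mul_of_nonneg_right ?_ (by positivity)
    exact Real.rpow_le_rpow hc.le (hlam lam _ (eigenProj_mem _ _) h0) s.2.1.le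

theorem completeSpace {C : ℝ} (hC : ∀ w : SpecHs Ω s, ‖toL2 w‖ ≤ C * ‖w‖) :
    CompleteSpace (SpecHs Ω s) := by
  refine Metric.complete_of_cauchySeq_tendsto fun u hu => ?_
  let T : SpecHs Ω s →L[ℝ] L2 Ω := toL2.mkContinuous C hC
  obtain ⟨w, hw⟩ := cauchySeq_tendsto_of_complete (T.uniformContinuous.comp_cauchySeq hu)
  -- The `L²` limit `w` is not yet known to have finite spectral norm, so the Cauchy estimate is
  -- passed to the limit on finite partial sums only.
  have hsum : ∀ ε > 0, ∃ N, ∀ n ≥ N, ∀ F : Finset PosReal,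
      ∑ lam ∈ F, (lam : ℝ) ^ (s : ℝ) * ‖eigenProj Ω lam (toL2 (u n) - w)‖ ^ 2 ≤ ε ^ 2 := by
    intro ε hε
    obtain ⟨N, hN⟩ := Metric.cauchySeq_iff.1 hu ε hε
    refine ⟨N, fun n hn F => ?_⟩
    have hlim : Tendsto (fun m => ∑ lam ∈ F,
        (lam : ℝ) ^ (s : ℝ) * ‖eigenProj Ω lam (toL2 (u n) - T (u m))‖ ^ 2) atTop
        (𝓝 (∑ lam ∈ F, (lam : ℝ) ^ (s : ℝ) * ‖eigenProj Ω lam (toL2 (u n) - w)‖ ^ 2)) := by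
      refine tendsto_finsetSum _ fun lam _ => ?_
      have h1 := ((eigenProj Ω lam).continuous.tendsto _).comp (hw.const_sub (toL2 (u n)))
      exact (h1.norm.pow 2).const_mul _
    refine le_of_tendsto hlim ?_
    filter_upwards [eventually_ge_atTop N] with m hm
    have h2 := hN n hn m hm
    rw [dist_eq_norm] at h2
    have h3 := sum_le_norm_sq (u n - u m) F
    rw [map_sub] at h3
    exact h3.trans (pow_le_pow_left₀ (norm_nonneg _) h2.le 2)
  have hwc : w ∈ (⨆ lam : PosReal, dirichletEigenspace Ω lam).topologicalClosure :=
    (Submodule.isClosed_topologicalClosure _).mem_of_tendsto hw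
      (Eventually.of_forall fun k => toL2_mem (u k))
  have hws : w ∈ spectralSubmodule Ω s := by
    -- Uniformly bounded partial sums put `u N - w` in the space, hence also `w`.
    obtain ⟨N, hN⟩ := hsum 1 one_pos
    have h4 : toL2 (u N) - w ∈ spectralSubmodule Ω s :=
      ⟨Submodule.sub_mem _ (toL2_mem _) hwc, summable_of_sum_le
        (fun lam => mul_nonneg (Real.rpow_nonneg lam.2.le _) (by positivity)) (hN N le_rfl)⟩
    have h5 := Submodule.sub_mem _ (u N).2 h4
    have h6 : toL2 (u N) - (toL2 (u N) - w) ∈ spectralSubmodule Ω s := h5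
    rwa [sub_sub_cancel] at h6
  let w' : SpecHs Ω s := ⟨w, hws⟩
  refine ⟨w', Metric.tendsto_atTop.2 fun ε hε => ?_⟩
  obtain ⟨N, hN⟩ := hsum (ε / 2) (by positivity)
  refine ⟨N, fun n hn => ?_⟩
  have h7 : ‖u n - w'‖ ^ 2 ≤ (ε / 2) ^ 2 := by
    refine hasSum_le_of_sum_le (hasSum_norm_sq (u n - w')) fun F => ?_
    rw [map_sub]
    exact hN n hn F
  rw [dist_eq_norm]
  have := le_of_sq_le_sq h7 (by positivity)
  linarith

/-- Translation estimate in the spectral space: the part with eigenvalues at most `Lam` is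
controlled in `H_0^1(Ω)`, the rest is small in `L²(Ω)`. -/
theorem norm_translationSub_le (hΩ : MeasurableSet Ω) (z : Eucl d) (w : SpecHs Ω s) {Lam : ℝ}
    (hLam : 0 < Lam) : ‖translationSub hΩ z (toL2 w)‖ ≤
      ‖z‖ * (√Lam * ‖toL2 w‖) + 2 * (√(Lam ^ (s : ℝ))⁻¹ * ‖w‖) := by
  classical
  have hP : ∀ lam : PosReal, eigenProj Ω lam (toL2 w) ∈ dirichletEigenspace Ω lam :=
    fun lam => eigenProj_mem _ _
  have hLs : 0 < Lam ^ (s : ℝ) := Real.rpow_pos_of_pos hLam _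
  have h := ((translationSub hΩ z).continuous.tendsto _).comp (hasSum_eigenProj (toL2_mem w))
  refine le_of_tendsto h.norm (Eventually.of_forall fun F => ?_)
  simp only [Function.comp_apply]
  -- Low eigenvalues use the gradient bound; for high ones `Lam ^ s ≤ lam ^ s` makes the `L²` norm
  -- small, and a translation difference at most doubles it.
  rw [← Finset.sum_filter_add_sum_filter_not F (fun lam : PosReal => (lam : ℝ) ≤ Lam), map_add]
  refine (norm_add_le _ _).trans (add_le_add ?_ ?_)
  · refine (norm_translationSub_sum_le hΩ z (fun lam hlam => (Finset.mem_filter.1 hlam).2)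
      hP).trans ?_
    gcongr
    refine le_of_sq_le_sq ?_ (norm_nonneg _)
    rw [norm_sum_eigen_sq _ hP]
    exact sum_le_hasSum _ (fun lam _ => by positivity) (hasSum_norm_eigenProj_sq (toL2_mem w))
  · refine (FracSob.norm_translationSub_le hΩ z _).trans ?_
    gcongr
    refine le_of_sq_le_sq ?_ (by positivity)
    rw [norm_sum_eigen_sq _ hP, mul_pow, Real.sq_sqrt (by positivity), inv_mul_eq_div,
      le_div_iff₀ hLs, Finset.sum_mul]
    refine le_trans (Finset.sum_le_sum fun lam hlam => ?_) (sum_le_norm_sq w _)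
    rw [mul_comm]
    refine mul_le_mul_of_nonneg_right ?_ (by positivity)
    exact Real.rpow_le_rpow hLam.le (not_le.1 (Finset.mem_filter.1 hlam).2).le s.2.1.le

/-- Translations are equicontinuous on bounded subsets of the spectral space. -/
theorem exists_norm_translationSub_le (hΩ : MeasurableSet Ω) {C : ℝ} (hC0 : 0 ≤ C)
    (hC : ∀ w : SpecHs Ω s, ‖toL2 w‖ ≤ C * ‖w‖) {M : ℝ} (hM : 0 ≤ M) {ε : ℝ} (hε : 0 < ε) :
    ∃ δ > 0, ∀ z : Eucl d, ‖z‖ < δ → ∀ w : SpecHs Ω s, ‖w‖ ≤ M →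
      ‖translationSub hΩ z (toL2 w)‖ ≤ ε := by
  have hlim : Tendsto (fun Lam : ℝ => 2 * (√(Lam ^ (s : ℝ))⁻¹ * M)) atTop (𝓝 0) := by
    have h1 := ((tendsto_rpow_atTop s.2.1).inv_tendsto_atTop.sqrt.mul_const M).const_mul 2
    simpa using h1
  obtain ⟨Lam, hLam1, hLam0⟩ := ((hlim.eventually_lt_const (half_pos hε)).and
    (eventually_gt_atTop 0)).exists
  -- `Lam` has made the high part smaller than `ε / 2`; this radius does the same for the low part,
  -- with `+ 1` keeping the denominator positive.
  refine ⟨ε / 2 / (√Lam * (C * M) + 1), by positivity, fun z hz w hw => ?_⟩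
  refine (norm_translationSub_le hΩ z w hLam0).trans ?_
  have h2 : ‖toL2 w‖ ≤ C * M := (hC w).trans (by gcongr)
  have h3 : ‖z‖ * (√Lam * ‖toL2 w‖) ≤ ε / 2 := by
    rw [lt_div_iff₀ (by positivity)] at hz
    refine le_trans ?_ hz.le
    gcongr
    refine le_trans ?_ (le_add_of_nonneg_right zero_le_one)
    gcongr
  have h4 : 2 * (√(Lam ^ (s : ℝ))⁻¹ * ‖w‖) ≤ 2 * (√(Lam ^ (s : ℝ))⁻¹ * M) := by gcongr
  linarith

/-- Bounded sequences of the spectral space that converge weakly in `L²(Ω)` converge in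
measure. -/
theorem tendstoInMeasure (hΩo : IsOpen Ω) (hΩf : volume Ω < ⊤) {C : ℝ} (hC0 : 0 ≤ C)
    (hC : ∀ w : SpecHs Ω s, ‖toL2 w‖ ≤ C * ‖w‖) {u : ℕ → SpecHs Ω s} {w : SpecHs Ω s} {M : ℝ}
    (hM : ∀ k, ‖u k‖ ≤ M)
    (hu : ∀ f, Tendsto (fun k => inner ℝ (toL2 (u k)) f) atTop (𝓝 (inner ℝ (toL2 w) f))) :
    TendstoInMeasure (volume.restrict Ω) (fun k => toL2 (u k)) atTop (toL2 w) := by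
  have hΩ := hΩo.measurableSet
  refine tendstoInMeasure_of_weak_of_oscillation subset_rfl hΩo hΩf hu fun η hη => ?_
  have hB : volume Ω ^ (1 / 2 : ℝ) ≠ ⊤ := ENNReal.rpow_ne_top_of_nonneg (by norm_num) hΩf.ne
  have hlim : Tendsto (fun ε : ℝ => ENNReal.ofReal ε * volume Ω ^ (1 / 2 : ℝ)) (𝓝[>] 0)
      (𝓝 0) := by
    have h1 : Tendsto (fun ε : ℝ => ε) (𝓝[>] 0) (𝓝 0) := nhdsWithin_le_nhds
    simpa using ENNReal.Tendsto.mul_const (ENNReal.tendsto_ofReal h1) (Or.inr hB)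
  -- The `L²` tolerance `ε` is chosen to become at most `η` after Cauchy–Schwarz contributes `volume
  -- Ω ^ (1 / 2)`.
  obtain ⟨ε, hε1, hε0⟩ := ((ENNReal.tendsto_nhds_zero.1 hlim η (pos_iff_ne_zero.2 hη)).and
    self_mem_nhdsWithin).exists
  have hM0 : 0 ≤ M := (norm_nonneg _).trans (hM 0)
  obtain ⟨δ, hδ0, hδ⟩ := exists_norm_translationSub_le hΩ hC0 hC
    (add_nonneg hM0 (norm_nonneg w)) hε0
  have hlt : ∀ᶠ h : ℝ in 𝓝[>] 0, h < δ := nhdsWithin_le_nhds (eventually_lt_nhds hδ0)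
  filter_upwards [hlt, self_mem_nhdsWithin] with h hh hh0 k
  have hm : ∀ f : L2 Ω, Measurable f := fun f => (Lp.stronglyMeasurable f).measurable
  refine lintegral_oscillation_le_of_translation (w := fun x => toL2 (u k) x - toL2 w x)
    ((hm _).sub (hm _)) (fun z hz => ?_) hΩ hh0
  have hae : toL2 (u k - w) =ᵐ[volume.restrict Ω] fun x => toL2 (u k) x - toL2 w x := by
    rw [map_sub]
    exact Lp.coeFn_sub _ _
  refine (lintegral_translation_le hΩ z hae).trans (le_trans ?_ hε1)
  gcongr
  rw [← ofReal_norm]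
  refine ENNReal.ofReal_le_ofReal (hδ z ((mem_ball_zero_iff.1 hz).trans hh) _ ?_)
  exact (norm_sub_le _ _).trans (by gcongr; exact hM k)

theorem hasSolution (hd : 1 ≤ d) (hΩo : IsOpen Ω) (hb : Bornology.IsBounded Ω)
    {F : SpecHs Ω s → ℝ} (hF : IsAdmissible F) {α β : ℝ} (hα : 0 < α) (hβ : 0 < β) :
    HasSolution Ω (fun w : SpecHs Ω s => toL2 w) F α β := by
  obtain ⟨C, hC0, hC⟩ := exists_norm_toL2_le (s := s) hd hΩo.measurableSet hb
  have : CompleteSpace (SpecHs Ω s) := completeSpace hC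
  refine hasSolution_of_tendstoInMeasure hb.measure_lt_top
    (fun w => (Lp.stronglyMeasurable _).measurable) (fun u w M hM hu => ?_) hF hα hβ
  exact tendstoInMeasure hΩo hb.measure_lt_top hC0 hC hM
    (tendsto_inner_map_of_weak (toL2.mkContinuous C hC) hu)

end SpecHs

end FracSob

end

/-! ### Existence of minimizers in the three spaces -/

theorem mainTheorem9 {d : ℕ} (hd : 1 ≤ d) (Ω : Set (Eucl d)) (hΩ : IsBoundedLipschitzDomain Ω)
    (s : Set.Ioo (0 : ℝ) 1) (hs : (s : ℝ) ≠ 1 / 2) (α β : ℝ) (hα : 0 < α) (hβ : 0 < β) :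
    -- `W = H_0^s(Ω)` with the inner product of `H^s(Ω)`
    (∀ F : H0s Ω s → ℝ, IsAdmissible F → HasSolution Ω (fun w => Hs.toL2 w.1) F α β) ∧
    -- `W = H̃^s(Ω)` with the inner product of `H^s(ℝ^d)`
    (∀ F : HTilde Ω s → ℝ, IsAdmissible F → HasSolution Ω (fun w => Hs.toL2 w.1) F α β) ∧
    -- `W = ℍ^s(Ω)` with the spectral inner product
    (∀ F : SpecHs Ω s → ℝ, IsAdmissible F →
      HasSolution Ω (fun w => SpecHs.toL2 w) F α β) := by
  have hf : volume Ω < ⊤ := hΩ.isBounded.measure_lt_top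
  -- The ambient domain `D` is `Ω` for the first space and `ℝ^d` for the second.
  exact ⟨fun F hF => Hs.hasSolution subset_rfl hΩ.isOpen hf
      (Submodule.isClosed_topologicalClosure _) hF hα hβ,
    fun F hF => Hs.hasSolution (Set.subset_univ Ω) hΩ.isOpen hf (isClosed_HTilde Ω s) hF hα hβ,
    fun F hF => SpecHs.hasSolution hd hΩ.isOpen hΩ.isBounded hF hα hβ⟩
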